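/- For an open set $\Omega\subset\mathbb C^d$, an analytic symbol in $\Omega$ is a formal series $a(x;h)=\sum_{k\ge 0}h^k a_k(x)$ with every $a_k$ holomorphic in $\Omega$, such that for each compact $K\subset\Omega$ there is $C>0$ with $|a_k(x)|\le C^{k+1}k^k$ for all $x\in K$ and $k\ge 0$ (where $0^0=1$). For formal symbols on open subsets of $\mathbb C^2$, with coordinates $(z,\zeta)$, the Weyl composition is $$a\# b=\sum_{\alpha,\beta,\ell,m\ge 0}h^{\alpha+\beta+\ell+m}\,\frac{(-1)^{\beta}}{(2i)^{\alpha+\beta}\,\alpha!\,\beta!}\,\bigl(\partial_\zeta^{\alpha}\partial_z^{\beta}a_\ell\bigr)\bigl(\partial_z^{\alpha}\partial_\zeta^{\beta}b_m\bigr).$$ A symbol $a$ determines the formal Weyl-quantized pseudodifferential operator $\hat a$, with $\hat a\circ\hat b=\widehat{a\# b}$, and $e^{\hat a}=\sum_{n\ge0}\hat a^{\,n}/n!$ is the operator whose symbol has as its coefficient of $h^k$ the sum over $n$ of the coefficients of $h^k$ in $\frac1{n!}\,a\#\cdots\# a$ ($n$ factors), the series converging locally uniformly. Proposition. Let $q=\sum_{\ell\ge0}h^\ell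 q_\ell$ be an analytic symbol in an open neighbourhood of the origin in $\mathbb C^2$ such that, in that neighbourhood, $q_0(z,\zeta)=g(z\zeta)$ and $q_1(z,\zeta)=g_1(z\zeta)$ for some functions $g,g_1$ (which are then necessarily holomorphic near $0\in\mathbb C$), where $g(0)=0$ and $g'(0)\ne0$. Then there exist an analytic symbol $a(z,\zeta;h)$ in a neighbourhood of the origin in $\mathbb C^2$ and an analytic symbol $G(w;h)=\sum_{\ell\ge0}h^\ell G_\ell(w)$ in a neighbourhood of $0\in\mathbb C$, with $G_0=g$ there, such that $e^{\hat a}$ and $e^{-\hat a}$ are well defined with analytic symbols in a neighbourhood of the origin, and there, as formal Weyl-quantized operators (that is, coefficient by coefficient in $h$ for their symbols), $$e^{\hat a}\circ\hat q\circ e^{-\hat a}=\hat b,\qquad b(z,\zeta;h)=G(z\zeta;h).$$ -/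

import Mathlib

noncomputable section

namespace AnalyticSymbols

/-- A formal power series `a(x; h) = ∑ h ^ k a_k(x)` whose coefficients are functions on `E`;
the coefficient of `h ^ k` is `a k`. -/
abbrev FormalSymbol (E : Type*) := ℕ → E → ℂ

/-- `a` is a (formal, classical) analytic symbol in `Ω`: all coefficients are holomorphic in `Ω`,
and on each compact subset of `Ω` one has `|a_k| ≤ C ^ (k + 1) k ^ k` for all `k`
(with `0 ^ 0 = 1`). Values outside `Ω` play no role. -/
def IsAnalyticSymbol {E : Type*} [NormedAddCommGroup E] [NormedSpace ℂ E]
    (Ω : Set E) (a : FormalSymbol E) : Prop :=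
  (∀ k, DifferentiableOn ℂ (a k) Ω) ∧
    ∀ K ⊆ Ω, IsCompact K → ∃ C : ℝ, 0 < C ∧
      ∀ k : ℕ, ∀ x ∈ K, ‖a k x‖ ≤ C ^ (k + 1) * (k : ℝ) ^ k

/-- The mixed partial derivative `∂_z ^ α ∂_ζ ^ β f` of a function of `(z, ζ) ∈ ℂ²`. -/
def partialDeriv (α β : ℕ) (f : ℂ × ℂ → ℂ) (p : ℂ × ℂ) : ℂ :=
  iteratedDeriv α (fun z => iteratedDeriv β (fun ζ => f (z, ζ)) p.2) p.1

/-- The Weyl composition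
`a # b = exp ((i h / 2) (D_ζ D_w - D_ω D_z)) a(z, ζ; h) b(w, ω; h)` at `w = z`, `ω = ζ`,
where `D = -i ∂`. Its coefficient of `h ^ k` is the sum over `α + β + l + m = k` of
`(-1) ^ β / ((2 i) ^ (α + β) α! β!) (∂_ζ ^ α ∂_z ^ β a_l) (∂_z ^ α ∂_ζ ^ β b_m)`. -/
def weylMul (a b : FormalSymbol (ℂ × ℂ)) : FormalSymbol (ℂ × ℂ) := fun k p =>
  ∑ d ∈ Finset.HasAntidiagonal.antidiagonal k,
    ∑ s ∈ Finset.HasAntidiagonal.antidiagonal d.1,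
      ∑ t ∈ Finset.HasAntidiagonal.antidiagonal d.2,
      (-1 : ℂ) ^ s.2 /
          ((2 * Complex.I) ^ (s.1 + s.2) * (s.1.factorial : ℂ) * (s.2.factorial : ℂ)) *
        (partialDeriv s.2 s.1 (a t.1) p * partialDeriv s.1 s.2 (b t.2) p)

/-- The `n`-th power of `a` for the Weyl composition; the `0`-th power is the symbol `1`. -/
def weylPow (a : FormalSymbol (ℂ × ℂ)) : ℕ → FormalSymbol (ℂ × ℂ)
  | 0 => fun k _ => if k = 0 then 1 else 0
  | n + 1 => weylMul (weylPow a n) a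

/-- `e` is the Weyl symbol of `exp â = ∑ â ^ n / n!` on `Ω`: for each `k`, the series of the
coefficients of `h ^ k` converges to `e_k`, locally uniformly on `Ω`. -/
def IsWeylExp (Ω : Set (ℂ × ℂ)) (a e : FormalSymbol (ℂ × ℂ)) : Prop :=
  ∀ k, HasSumLocallyUniformlyOn
    (fun (n : ℕ) (p : ℂ × ℂ) => ((n.factorial : ℂ))⁻¹ * weylPow a n k p) (e k) Ω

end AnalyticSymbols

end

/-! Everything takes place on Taylor expansions at the origin. Series in h, z, ζ under the Weyl
product form an associative algebra in which h is central. It is graded by m - n on the monomials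
h^k z^m ζ^n, and the diagonal part, m = n, consists of the functions of zζ. A Boutet de Monvel–Krée
norm makes the series of finite norm a Banach algebra, `WeylAlgebra`; the key estimate is
`bk_mul_le`, which gives `nrm_mul_le`. The dilation z → sz, ζ → sζ, h → s²h is an algebra
homomorphism, contractive for |s| ≤ 1. Any analytic symbol near 0 enters the Banach algebra after a
strong enough dilation (`IsAnalyticSymbol.exists_sym`), and undoing the dilation turns every
element, and the exponential of every element, into an analytic symbol near 0
(`isAnalyticSymbol_sym`, `isWeylExp_sym`). The theorem thus reduces to a conjugation inside a Banach
algebra, `exists_conjugation`.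

There the dilated symbol is written F + κh + hR, where F is a series Σ c_j (zζ)^j in Weyl powers and
c_1 ≠ 0 because g'(0) ≠ 0. One looks for an off-diagonal u and a diagonal S with (1 + u)(F + κh +
hR) = (F + κh + hS)(1 + u). The commutator of zζ with u is exactly -ih(z∂_z - ζ∂_ζ)u. The
eigenvalues m - n are nonzero integers off the diagonal, so there are no small divisors, and u = Jy
with [zζ, u] = hy for a bounded J. After division by h the equation reads c_1 y + Ey = R + uR - S -
Su, where E gathers the powers j ≥ 2 of zζ. Dilation makes E small, and also R, from which κ has
removed the constant term. The equation is then a small perturbation of an invertible linear one: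
the off-diagonal part determines y by the open mapping form of the inverse function theorem
(`exists_small_solution`), the diagonal part determines S. Finally 1 + u is close to 1, hence an
exponential. -/

noncomputable section

/-! ### Formal double power series and the Weyl bidifferential operators -/

namespace AnalyticSymbols

open Finset PowerSeries

/-- Formal power series in `(z, ζ)`: the outer variable is `z`, the inner one is `ζ`. -/
abbrev DoubleSeries := PowerSeries (PowerSeries ℂ)

namespace DoubleSeries

/-- The coefficient of `z ^ m ζ ^ n`. -/
def cf (f : DoubleSeries) (m n : ℕ) : ℂ := coeff n (coeff m f)

/-- The series with given coefficients. -/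
def ofCf (c : ℕ → ℕ → ℂ) : DoubleSeries := PowerSeries.mk fun m => PowerSeries.mk fun n => c m n

@[simp] lemma cf_ofCf (c : ℕ → ℕ → ℂ) (m n : ℕ) : cf (ofCf c) m n = c m n := by
  simp [cf, ofCf]

lemma ext_cf {f g : DoubleSeries} (h : ∀ m n, cf f m n = cf g m n) : f = g :=
  PowerSeries.ext fun m => PowerSeries.ext fun n => h m n

@[simp] lemma cf_add (f g : DoubleSeries) (m n : ℕ) : cf (f + g) m n = cf f m n + cf g m n := by
  simp [cf]

@[simp] lemma cf_sub (f g : DoubleSeries) (m n : ℕ) : cf (f - g) m n = cf f m n - cf g m n := by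
  simp [cf]

@[simp] lemma cf_zero (m n : ℕ) : cf 0 m n = 0 := by simp [cf]

@[simp] lemma cf_smul (c : ℂ) (f : DoubleSeries) (m n : ℕ) : cf (c • f) m n = c * cf f m n := by
  simp [cf]

lemma cf_sum {ι : Type*} (s : Finset ι) (f : ι → DoubleSeries) (m n : ℕ) :
    cf (∑ i ∈ s, f i) m n = ∑ i ∈ s, cf (f i) m n := by
  simp [cf]

lemma cf_one (m n : ℕ) : cf 1 m n = if m = 0 ∧ n = 0 then 1 else 0 := by
  rcases eq_or_ne m 0 with rfl | hm <;> simp_all [cf, PowerSeries.coeff_one]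

lemma cf_mul (f g : DoubleSeries) (m n : ℕ) :
    cf (f * g) m n = ∑ i ∈ antidiagonal m, ∑ j ∈ antidiagonal n, cf f i.1 j.1 * cf g i.2 j.2 := by
  simp [cf, PowerSeries.coeff_mul]

/-- The derivative `∂_z`. -/
def dz : DoubleSeries →ₗ[ℂ] DoubleSeries where
  toFun f := PowerSeries.derivative (PowerSeries ℂ) f
  map_add' f g := map_add _ f g
  map_smul' c f := by
    apply ext_cf; intro m n
    simp [cf, PowerSeries.coeff_derivative]

/-- The derivative `∂_ζ`. -/
def dζ : DoubleSeries →ₗ[ℂ] DoubleSeries where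
  toFun f := PowerSeries.mk fun m => PowerSeries.derivative ℂ (coeff m f)
  map_add' f g := by ext; simp
  map_smul' c f := by ext; simp

lemma cf_dz (f : DoubleSeries) (m n : ℕ) : cf (dz f) m n = (m + 1) * cf f (m + 1) n := by
  have : (m : PowerSeries ℂ) + 1 = C ((m : ℂ) + 1) := by simp
  simp only [dz, cf, LinearMap.coe_mk, AddHom.coe_mk, PowerSeries.coeff_derivative, this]
  rw [PowerSeries.coeff_mul_C, mul_comm]

lemma cf_dζ (f : DoubleSeries) (m n : ℕ) : cf (dζ f) m n = (n + 1) * cf f m (n + 1) := by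
  simp [dζ, cf, PowerSeries.coeff_derivative, mul_comm]

lemma dz_mul (f g : DoubleSeries) : dz (f * g) = dz f * g + f * dz g := by
  simp only [dz, LinearMap.coe_mk, AddHom.coe_mk, Derivation.leibniz, smul_eq_mul]
  ring

lemma dζ_mul (f g : DoubleSeries) : dζ (f * g) = dζ f * g + f * dζ g := by
  ext1 m
  simp only [dζ, LinearMap.coe_mk, AddHom.coe_mk, PowerSeries.coeff_mk, PowerSeries.coeff_mul,
    map_sum, map_add, ← Finset.sum_add_distrib, Derivation.leibniz, smul_eq_mul]
  exact Finset.sum_congr rfl fun i _ => by ring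

lemma dz_dζ_comm (f : DoubleSeries) : dz (dζ f) = dζ (dz f) := by
  apply ext_cf; intro m n
  simp only [cf_dz, cf_dζ]; ring

/-- `∂_z ^ α ∂_ζ ^ β`. -/
def dd (α β : ℕ) (f : DoubleSeries) : DoubleSeries := dz^[α] (dζ^[β] f)

lemma dz_iterate_dζ_comm (α : ℕ) (f : DoubleSeries) : dz^[α] (dζ f) = dζ (dz^[α] f) :=
  (Function.Commute.iterate_left (f := dz) (g := dζ) (fun f => dz_dζ_comm f) α) f

lemma dd_zero_zero (f : DoubleSeries) : dd 0 0 f = f := rfl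

lemma dd_dz (α β : ℕ) (f : DoubleSeries) : dd α β (dz f) = dd (α + 1) β f := by
  have h := (Function.Commute.iterate_right (f := dz) (g := dζ) (fun f => dz_dζ_comm f) β) f
  simp only [dd, Function.iterate_succ, Function.comp_apply]
  rw [← h]

lemma dd_dζ (α β : ℕ) (f : DoubleSeries) : dd α β (dζ f) = dd α (β + 1) f := rfl

lemma dz_dd (α β : ℕ) (f : DoubleSeries) : dz (dd α β f) = dd (α + 1) β f := by
  simp only [dd, Function.iterate_succ_apply']

lemma dζ_dd (α β : ℕ) (f : DoubleSeries) : dζ (dd α β f) = dd α (β + 1) f := by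
  simp only [dd, Function.iterate_succ_apply' _ β]
  rw [dz_iterate_dζ_comm]

lemma dd_add (α β : ℕ) (f g : DoubleSeries) : dd α β (f + g) = dd α β f + dd α β g := by
  simp only [dd, ← Module.End.coe_pow, map_add]

lemma dd_smul (α β : ℕ) (c : ℂ) (f : DoubleSeries) : dd α β (c • f) = c • dd α β f := by
  simp only [dd, ← Module.End.coe_pow, map_smul]

lemma cf_dd (α β : ℕ) (f : DoubleSeries) (m n : ℕ) :
    cf (dd α β f) m n =
      ((m + 1).ascFactorial α : ℂ) * ((n + 1).ascFactorial β : ℂ) * cf f (m + α) (n + β) := by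
  have key : ∀ n k : ℕ, ((n : ℂ) + 1) * ((n + 1 + 1).ascFactorial k : ℂ) =
      ((n + 1).ascFactorial (k + 1) : ℂ) := fun n k => by
    rw [Nat.ascFactorial_succ, ← Nat.succ_ascFactorial]; push_cast; rfl
  induction α generalizing m n with
  | zero =>
    induction β generalizing m n with
    | zero => simp [dd_zero_zero]
    | succ β ih =>
      rw [← dζ_dd, cf_dζ, ih, ← key, add_assoc n 1 β, add_comm 1 β]
      ring
  | succ α ih =>
    rw [← dz_dd, cf_dz, ih, ← key, add_assoc m 1 α, add_comm 1 α]
    ring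

/-- The coefficients of the Weyl composition. -/
def wc (s : ℕ × ℕ) : ℂ :=
  (-1 : ℂ) ^ s.2 / ((2 * Complex.I) ^ (s.1 + s.2) * (s.1.factorial : ℂ) * (s.2.factorial : ℂ))

/-- The `n`-th bidifferential operator of the Weyl composition. -/
def bidiff (n : ℕ) (f g : DoubleSeries) : DoubleSeries :=
  ∑ s ∈ antidiagonal n, wc s • (dd s.2 s.1 f * dd s.1 s.2 g)

lemma bidiff_zero (f g : DoubleSeries) : bidiff 0 f g = f * g := by
  simp [bidiff, wc, dd_zero_zero]

lemma wc_succ_left (i j : ℕ) : ((i + 1 : ℕ) : ℂ) * wc (i + 1, j) = (2 * Complex.I)⁻¹ * wc (i, j) := by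
  have h1 : (i.factorial : ℂ) ≠ 0 := by exact_mod_cast i.factorial_ne_zero
  have h2 : (j.factorial : ℂ) ≠ 0 := by exact_mod_cast j.factorial_ne_zero
  have h3 : ((i : ℂ) + 1) ≠ 0 := by exact_mod_cast i.succ_ne_zero
  have h4 := Complex.I_ne_zero
  simp only [wc, Nat.factorial_succ]
  push_cast
  field_simp
  ring

lemma wc_succ_right (i j : ℕ) :
    ((j + 1 : ℕ) : ℂ) * wc (i, j + 1) = -(2 * Complex.I)⁻¹ * wc (i, j) := by
  have h1 : (i.factorial : ℂ) ≠ 0 := by exact_mod_cast i.factorial_ne_zero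
  have h2 : (j.factorial : ℂ) ≠ 0 := by exact_mod_cast j.factorial_ne_zero
  have h3 : ((j : ℂ) + 1) ≠ 0 := by exact_mod_cast j.succ_ne_zero
  have h4 := Complex.I_ne_zero
  simp only [wc, Nat.factorial_succ]
  push_cast
  field_simp
  ring

/-- The n-th operator is P^n / n! for the Poisson operator P = (2i)⁻¹(∂_ζ ⊗ ∂_z - ∂_z ⊗ ∂_ζ).
Splitting the factor n + 1 as α + β and absorbing each summand into its factorial produces the two
terms of P. Later facts about `bidiff` follow from this recursion by induction. -/
lemma bidiff_succ (n : ℕ) (f g : DoubleSeries) :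
    ((n + 1 : ℕ) : ℂ) • bidiff (n + 1) f g =
      (2 * Complex.I)⁻¹ • (bidiff n (dζ f) (dz g) - bidiff n (dz f) (dζ g)) := by
  have key : ((n + 1 : ℕ) : ℂ) • bidiff (n + 1) f g =
      ∑ s ∈ antidiagonal (n + 1), ((s.1 : ℂ) * wc s) • (dd s.2 s.1 f * dd s.1 s.2 g) +
      ∑ s ∈ antidiagonal (n + 1), ((s.2 : ℂ) * wc s) • (dd s.2 s.1 f * dd s.1 s.2 g) := by
    rw [bidiff, Finset.smul_sum, ← Finset.sum_add_distrib]
    refine Finset.sum_congr rfl fun s hs => ?_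
    rw [← mem_antidiagonal.1 hs, smul_smul, ← add_smul]
    push_cast
    rw [add_mul]
  rw [key, Finset.Nat.sum_antidiagonal_succ, Finset.Nat.sum_antidiagonal_succ', smul_sub, bidiff,
    bidiff, Finset.smul_sum, Finset.smul_sum, sub_eq_add_neg, ← Finset.sum_neg_distrib]
  simp only [Nat.cast_zero, zero_mul, zero_smul, zero_add]
  congr 1 <;> refine Finset.sum_congr rfl fun s _ => ?_
  · rw [wc_succ_left, smul_smul, dd_dζ, dd_dz]
  · rw [wc_succ_right, smul_smul, ← neg_smul, dd_dζ, dd_dz, neg_mul]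

lemma bidiff_add_left (n : ℕ) (f f' g : DoubleSeries) :
    bidiff n (f + f') g = bidiff n f g + bidiff n f' g := by
  simp only [bidiff, dd_add, add_mul, smul_add, sum_add_distrib]

lemma bidiff_add_right (n : ℕ) (f g g' : DoubleSeries) :
    bidiff n f (g + g') = bidiff n f g + bidiff n f g' := by
  simp only [bidiff, dd_add, mul_add, smul_add, sum_add_distrib]

lemma bidiff_smul_left (n : ℕ) (c : ℂ) (f g : DoubleSeries) :
    bidiff n (c • f) g = c • bidiff n f g := by
  simp only [bidiff, dd_smul, smul_mul_assoc, Finset.smul_sum, smul_comm c]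

lemma bidiff_smul_right (n : ℕ) (c : ℂ) (f g : DoubleSeries) :
    bidiff n f (c • g) = c • bidiff n f g := by
  simp only [bidiff, dd_smul, mul_smul_comm, Finset.smul_sum, smul_comm c]

lemma bidiff_zero_left (n : ℕ) (g : DoubleSeries) : bidiff n 0 g = 0 := by
  simpa using bidiff_smul_left n 0 0 g

lemma bidiff_zero_right (n : ℕ) (f : DoubleSeries) : bidiff n f 0 = 0 := by
  simpa using bidiff_smul_right n 0 f 0

lemma dz_bidiff (n : ℕ) (f g : DoubleSeries) :
    dz (bidiff n f g) = bidiff n (dz f) g + bidiff n f (dz g) := by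
  simp only [bidiff, map_sum, map_smul, dz_mul, dz_dd, dd_dz, smul_add, sum_add_distrib]

lemma dζ_bidiff (n : ℕ) (f g : DoubleSeries) :
    dζ (bidiff n f g) = bidiff n (dζ f) g + bidiff n f (dζ g) := by
  simp only [bidiff, map_sum, map_smul, dζ_mul, dζ_dd, dd_dζ, smul_add, sum_add_distrib]

lemma smul_cast_succ_injective (n : ℕ) {f g : DoubleSeries}
    (h : ((n + 1 : ℕ) : ℂ) • f = ((n + 1 : ℕ) : ℂ) • g) : f = g :=
  smul_right_injective _ (by exact_mod_cast n.succ_ne_zero : ((n + 1 : ℕ) : ℂ) ≠ 0) h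

/-- Exchanging the two arguments changes the sign of the Poisson operator. -/
lemma bidiff_symm (n : ℕ) (f g : DoubleSeries) : bidiff n f g = (-1 : ℂ) ^ n • bidiff n g f := by
  induction n generalizing f g with
  | zero => simp [bidiff_zero, mul_comm]
  | succ n ih =>
    apply smul_cast_succ_injective n
    rw [bidiff_succ, smul_comm, bidiff_succ, ih (dζ f), ih (dz f), pow_succ]
    module

lemma bidiff_succ_of_const {f : DoubleSeries} (h1 : dz f = 0) (h2 : dζ f = 0) (n : ℕ)
    (g : DoubleSeries) : bidiff (n + 1) f g = 0 := by
  apply smul_cast_succ_injective n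
  rw [bidiff_succ, h1, h2]
  simp [bidiff_zero_left]

end DoubleSeries
end AnalyticSymbols

/-! ### The associative algebra of formal symbols -/

namespace AnalyticSymbols

open Finset PowerSeries DoubleSeries

/-- Formal symbols `∑ h ^ k a_k` whose coefficients are formal power series in `(z, ζ)`, with the
Weyl composition as multiplication. -/
structure WeylSeries where
  /-- The symbol with given coefficients. -/
  mk ::
  /-- The coefficients of the powers of `h`. -/
  coef : ℕ → DoubleSeries

namespace WeylSeries

instance : FunLike WeylSeries ℕ DoubleSeries :=
  ⟨coef, fun a b h => by cases a; cases b; simpa using h⟩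

lemma mk_apply (f : ℕ → DoubleSeries) (k : ℕ) : mk f k = f k := rfl

/-- Formal symbols as sequences of coefficients. -/
def equivFun : WeylSeries ≃ (ℕ → DoubleSeries) := ⟨coef, mk, fun _ => rfl, fun _ => rfl⟩

instance : AddCommGroup WeylSeries := equivFun.addCommGroup
instance : Module ℂ WeylSeries := equivFun.module ℂ

lemma add_apply (a b : WeylSeries) (k : ℕ) : (a + b) k = a k + b k := rfl
lemma sub_apply (a b : WeylSeries) (k : ℕ) : (a - b) k = a k - b k := rfl
lemma smul_apply (c : ℂ) (a : WeylSeries) (k : ℕ) : (c • a) k = c • a k := rfl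
lemma zero_apply (k : ℕ) : (0 : WeylSeries) k = 0 := rfl

@[ext] lemma ext {a b : WeylSeries} (h : ∀ k, a k = b k) : a = b := DFunLike.ext a b h

instance : Mul WeylSeries :=
  ⟨fun a b => mk fun k => ∑ d ∈ antidiagonal k, ∑ t ∈ antidiagonal d.2, bidiff d.1 (a t.1) (b t.2)⟩

lemma mul_apply (a b : WeylSeries) (k : ℕ) : (a * b) k =
    ∑ d ∈ antidiagonal k, ∑ t ∈ antidiagonal d.2, bidiff d.1 (a t.1) (b t.2) := rfl

lemma mul_apply_zero (a b : WeylSeries) : (a * b) 0 = a 0 * b 0 := by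
  simp [mul_apply, bidiff_zero]

protected lemma add_mul (a b c : WeylSeries) : (a + b) * c = a * c + b * c := by
  ext1 k
  simp only [mul_apply, add_apply, bidiff_add_left, sum_add_distrib]

protected lemma mul_add (a b c : WeylSeries) : a * (b + c) = a * b + a * c := by
  ext1 k
  simp only [mul_apply, add_apply, bidiff_add_right, sum_add_distrib]

protected lemma smul_mul (c : ℂ) (a b : WeylSeries) : (c • a) * b = c • (a * b) := by
  ext1 k
  simp only [mul_apply, smul_apply, bidiff_smul_left, Finset.smul_sum]

protected lemma mul_smul (c : ℂ) (a b : WeylSeries) : a * (c • b) = c • (a * b) := by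
  ext1 k
  simp only [mul_apply, smul_apply, bidiff_smul_right, Finset.smul_sum]

protected lemma sub_mul (a b c : WeylSeries) : (a - b) * c = a * c - b * c := by
  rw [eq_sub_iff_add_eq, ← WeylSeries.add_mul, sub_add_cancel]

protected lemma mul_sub (a b c : WeylSeries) : a * (b - c) = a * b - a * c := by
  rw [eq_sub_iff_add_eq, ← WeylSeries.mul_add, sub_add_cancel]

/-- The embedding of symbols that do not depend on `h`. -/
def const (f : DoubleSeries) : WeylSeries := mk fun k => if k = 0 then f else 0

instance : One WeylSeries := ⟨const 1⟩

lemma one_apply (k : ℕ) : (1 : WeylSeries) k = if k = 0 then 1 else 0 := rfl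

lemma const_mul_apply (f : DoubleSeries) (a : WeylSeries) (k : ℕ) :
    (const f * a) k = ∑ d ∈ antidiagonal k, bidiff d.1 f (a d.2) := by
  rw [mul_apply]
  refine sum_congr rfl fun d _ => ?_
  rw [Finset.sum_eq_single (0, d.2)]
  · simp [const, mk_apply]
  · rintro ⟨i, j⟩ hij hne
    have : i ≠ 0 := by rintro rfl; simp_all
    simp [const, mk_apply, this, bidiff_zero_left]
  · simp

lemma mul_const_apply (f : DoubleSeries) (a : WeylSeries) (k : ℕ) :
    (a * const f) k = ∑ d ∈ antidiagonal k, bidiff d.1 (a d.2) f := by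
  rw [mul_apply]
  refine sum_congr rfl fun d _ => ?_
  rw [Finset.sum_eq_single (d.2, 0)]
  · simp [const, mk_apply]
  · rintro ⟨i, j⟩ hij hne
    have : j ≠ 0 := by rintro rfl; simp_all
    simp [const, mk_apply, this, bidiff_zero_right]
  · simp

lemma bidiff_one_left (n : ℕ) (f : DoubleSeries) : bidiff n 1 f = if n = 0 then f else 0 := by
  cases n with
  | zero => simp [bidiff_zero]
  | succ n =>
    have h1 : dz 1 = 0 := ext_cf fun m n => by simp [cf_dz, cf_one]
    have h2 : dζ 1 = 0 := ext_cf fun m n => by simp [cf_dζ, cf_one]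
    simp [bidiff_succ_of_const h1 h2]

lemma bidiff_one_right (n : ℕ) (f : DoubleSeries) : bidiff n f 1 = if n = 0 then f else 0 := by
  rw [bidiff_symm, bidiff_one_left]
  split_ifs with h <;> simp [h]

protected lemma one_mul (a : WeylSeries) : 1 * a = a := by
  ext1 k
  refine (const_mul_apply 1 a k).trans ?_
  cases k <;> simp [bidiff_one_left, Finset.Nat.sum_antidiagonal_succ]

protected lemma mul_one (a : WeylSeries) : a * 1 = a := by
  ext1 k
  refine (mul_const_apply 1 a k).trans ?_
  cases k <;> simp [bidiff_one_right, Finset.Nat.sum_antidiagonal_succ]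

/-- The derivative with respect to `h`. -/
def dh (a : WeylSeries) : WeylSeries := mk fun k => ((k + 1 : ℕ) : ℂ) • a (k + 1)

/-- `∂_z` on formal symbols. -/
def pz (a : WeylSeries) : WeylSeries := mk fun k => dz (a k)

/-- `∂_ζ` on formal symbols. -/
def pζ (a : WeylSeries) : WeylSeries := mk fun k => dζ (a k)

lemma dh_apply (a : WeylSeries) (k : ℕ) : dh a k = ((k + 1 : ℕ) : ℂ) • a (k + 1) := rfl
lemma pz_apply (a : WeylSeries) (k : ℕ) : pz a k = dz (a k) := rfl
lemma pζ_apply (a : WeylSeries) (k : ℕ) : pζ a k = dζ (a k) := rfl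
lemma const_apply (f : DoubleSeries) (k : ℕ) : const f k = if k = 0 then f else 0 := rfl

lemma pz_mul (a b : WeylSeries) : pz (a * b) = pz a * b + a * pz b := by
  ext1 k
  simp only [pz_apply, mul_apply, add_apply, map_sum, dz_bidiff, sum_add_distrib]

lemma pζ_mul (a b : WeylSeries) : pζ (a * b) = pζ a * b + a * pζ b := by
  ext1 k
  simp only [pζ_apply, mul_apply, add_apply, map_sum, dζ_bidiff, sum_add_distrib]

/-- This is the h-derivative of exp(hP) applied to a ⊗ b: besides the Leibniz terms, P itself
appears. It trades one order in h for derivatives of the factors, which drives the proof of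
associativity. -/
lemma dh_mul (a b : WeylSeries) :
    dh (a * b) = dh a * b + a * dh b + (2 * Complex.I)⁻¹ • (pζ a * pz b - pz a * pζ b) := by
  ext1 k
  have key : dh (a * b) k =
      ∑ d ∈ antidiagonal (k + 1), (d.1 : ℂ) • ∑ t ∈ antidiagonal d.2,
        bidiff d.1 (a t.1) (b t.2) +
      ∑ d ∈ antidiagonal (k + 1), (d.2 : ℂ) • ∑ t ∈ antidiagonal d.2,
        bidiff d.1 (a t.1) (b t.2) := by
    rw [dh_apply, mul_apply, Finset.smul_sum, ← sum_add_distrib]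
    refine sum_congr rfl fun d hd => ?_
    rw [← mem_antidiagonal.1 hd, ← add_smul]
    push_cast; rfl
  have key2 : ∀ d : ℕ × ℕ, ((d.2 + 1 : ℕ) : ℂ) • ∑ t ∈ antidiagonal (d.2 + 1),
        bidiff d.1 (a t.1) (b t.2) =
      ∑ t ∈ antidiagonal d.2, bidiff d.1 (dh a t.1) (b t.2) +
      ∑ t ∈ antidiagonal d.2, bidiff d.1 (a t.1) (dh b t.2) := fun d => by
    have : ((d.2 + 1 : ℕ) : ℂ) • ∑ t ∈ antidiagonal (d.2 + 1), bidiff d.1 (a t.1) (b t.2) =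
      ∑ t ∈ antidiagonal (d.2 + 1), (t.1 : ℂ) • bidiff d.1 (a t.1) (b t.2) +
      ∑ t ∈ antidiagonal (d.2 + 1), (t.2 : ℂ) • bidiff d.1 (a t.1) (b t.2) := by
      rw [Finset.smul_sum, ← sum_add_distrib]
      refine sum_congr rfl fun t ht => ?_
      rw [← mem_antidiagonal.1 ht, ← add_smul]
      push_cast; rfl
    rw [this, Finset.Nat.sum_antidiagonal_succ, Finset.Nat.sum_antidiagonal_succ']
    simp only [Nat.cast_zero, zero_smul, zero_add, dh_apply, bidiff_smul_left, bidiff_smul_right]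
  rw [key, Finset.Nat.sum_antidiagonal_succ]
  simp only [Nat.cast_zero, zero_smul, zero_add]
  rw [Finset.Nat.sum_antidiagonal_succ']
  simp only [Nat.cast_zero, zero_smul, zero_add, key2, sum_add_distrib]
  rw [add_comm]
  simp only [add_apply, smul_apply, sub_apply, mul_apply]
  congr 1
  rw [← sum_sub_distrib, Finset.smul_sum]
  refine sum_congr rfl fun d _ => ?_
  rw [← sum_sub_distrib, Finset.smul_sum, Finset.smul_sum]
  refine sum_congr rfl fun t _ => ?_
  rw [bidiff_succ]
  rfl

/-- Order 0 is the commutative product. At order k + 1, both sides are differentiated in h: since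
∂_z and ∂_ζ are derivations, the two results expand into the same triple products up to bracketing,
which is settled at order k for all triples. -/
protected lemma mul_assoc (a b c : WeylSeries) : a * b * c = a * (b * c) := by
  ext1 k
  induction k generalizing a b c with
  | zero => simp only [mul_apply_zero, _root_.mul_assoc]
  | succ k ih =>
    apply smul_cast_succ_injective k
    change dh (a * b * c) k = dh (a * (b * c)) k
    rw [dh_mul, dh_mul a b, dh_mul a (b * c), dh_mul b c, pz_mul, pζ_mul, pz_mul, pζ_mul]
    simp only [WeylSeries.add_mul, WeylSeries.mul_add, WeylSeries.smul_mul, WeylSeries.mul_smul,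
      WeylSeries.sub_mul, WeylSeries.mul_sub, add_apply, smul_apply, sub_apply, ih]
    module

instance : Ring WeylSeries where
  __ := (inferInstance : AddCommGroup WeylSeries)
  left_distrib := WeylSeries.mul_add
  right_distrib := WeylSeries.add_mul
  zero_mul a := by simpa using WeylSeries.smul_mul 0 0 a
  mul_zero a := by simpa using WeylSeries.mul_smul 0 a 0
  mul_assoc := WeylSeries.mul_assoc
  one_mul := WeylSeries.one_mul
  mul_one := WeylSeries.mul_one

instance : Algebra ℂ WeylSeries := Algebra.ofModule WeylSeries.smul_mul
  fun c a b => WeylSeries.mul_smul c a b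

end WeylSeries
end AnalyticSymbols

/-! ### Grading, dilations, and the commutator with zζ -/

namespace AnalyticSymbols

open Finset PowerSeries DoubleSeries

namespace WeylSeries

lemma ext_cf {a b : WeylSeries} (h : ∀ k m n, cf (a k) m n = cf (b k) m n) : a = b :=
  ext fun k => DoubleSeries.ext_cf (h k)

lemma cf_mul (a b : WeylSeries) (k m n : ℕ) : cf ((a * b) k) m n =
    ∑ d ∈ antidiagonal k, ∑ t ∈ antidiagonal d.2, ∑ s ∈ antidiagonal d.1,
      ∑ i ∈ antidiagonal m, ∑ j ∈ antidiagonal n, wc s *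
        (((i.1 + 1).ascFactorial s.2 * (j.1 + 1).ascFactorial s.1 *
          cf (a t.1) (i.1 + s.2) (j.1 + s.1)) *
        ((i.2 + 1).ascFactorial s.1 * (j.2 + 1).ascFactorial s.2 *
          cf (b t.2) (i.2 + s.1) (j.2 + s.2))) := by
  simp only [mul_apply, bidiff, cf_sum, cf_smul, DoubleSeries.cf_mul, cf_dd, Finset.mul_sum]

/-- The monomials `z ^ m ζ ^ n` occurring in `a` satisfy `m - n ∈ S`. -/
def DegreeIn (S : Set ℤ) (a : WeylSeries) : Prop :=
  ∀ k m n, cf (a k) m n ≠ 0 → (m - n : ℤ) ∈ S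

/-- A term of the Weyl product removes α + β factors z and as many factors ζ from the two monomials
together, so m - n is additive. -/
lemma DegreeIn.mul {S T V : Set ℤ} {a b : WeylSeries} (ha : DegreeIn S a) (hb : DegreeIn T b)
    (h : ∀ s ∈ S, ∀ t ∈ T, s + t ∈ V) : DegreeIn V (a * b) := by
  intro k m n hne
  by_contra hV
  apply hne
  rw [cf_mul]
  refine sum_eq_zero fun d _ => sum_eq_zero fun t _ => sum_eq_zero fun s _ =>
    sum_eq_zero fun i hi => sum_eq_zero fun j hj => ?_
  by_contra h0
  simp only [mul_eq_zero, not_or] at h0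
  apply hV
  have h1 := h _ (ha _ _ _ h0.2.1.2) _ (hb _ _ _ h0.2.2.2)
  rw [HasAntidiagonal.mem_antidiagonal] at hi hj
  rw [← hi, ← hj]
  convert h1 using 1
  push_cast; ring

/-- Multiplication of the coefficient of `h ^ k z ^ m ζ ^ n` by `φ (k, m, n)`. -/
def mult (φ : ℕ × ℕ × ℕ → ℂ) : WeylSeries →ₗ[ℂ] WeylSeries where
  toFun a := mk fun k => ofCf fun m n => φ (k, m, n) * cf (a k) m n
  map_add' a b := ext_cf fun k m n => by simp [mk_apply, add_apply, mul_add]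
  map_smul' c a := ext_cf fun k m n => by simp [mk_apply, smul_apply, mul_left_comm]

@[simp] lemma cf_mult (φ : ℕ × ℕ × ℕ → ℂ) (a : WeylSeries) (k m n : ℕ) :
    cf (mult φ a k) m n = φ (k, m, n) * cf (a k) m n := by
  rw [mult, LinearMap.coe_mk, AddHom.coe_mk, mk_apply, cf_ofCf]

/-- The algebra homomorphism given by `z ↦ s z`, `ζ ↦ s ζ`, `h ↦ s ^ 2 h`. -/
def scale (s : ℂ) : WeylSeries →ₐ[ℂ] WeylSeries :=
  AlgHom.ofLinearMap (mult fun i => s ^ (2 * i.1 + i.2.1 + i.2.2))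
    (ext_cf fun k m n => by
      rw [cf_mult, one_apply]
      split_ifs with h
      · rw [cf_one]; split_ifs with h' <;> simp_all
      · simp)
    (fun a b => ext_cf fun k m n => by
      rw [cf_mult, cf_mul, cf_mul]
      simp only [Finset.mul_sum]
      refine sum_congr rfl fun d hd => sum_congr rfl fun t ht => sum_congr rfl fun u hu =>
        sum_congr rfl fun i hi => sum_congr rfl fun j hj => ?_
      rw [HasAntidiagonal.mem_antidiagonal] at hd ht hu hi hj
      -- The weight 2k + m + n is additive because each application of the Poisson operator removes
      -- one z and one ζ and creates one h, which has weight 2.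
      have : 2 * k + m + n = (2 * t.1 + (i.1 + u.2) + (j.1 + u.1)) +
          (2 * t.2 + (i.2 + u.1) + (j.2 + u.2)) := by omega
      rw [this, pow_add, cf_mult, cf_mult]
      ring)

@[simp] lemma cf_scale (s : ℂ) (a : WeylSeries) (k m n : ℕ) :
    cf (scale s a k) m n = s ^ (2 * k + m + n) * cf (a k) m n := by
  rw [scale, AlgHom.ofLinearMap_apply, cf_mult]

lemma scale_scale (s t : ℂ) (a : WeylSeries) : scale s (scale t a) = scale (s * t) a :=
  ext_cf fun k m n => by simp [mul_pow, mul_assoc]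

lemma scale_one (a : WeylSeries) : scale 1 a = a := ext_cf fun k m n => by simp

/-- The symbol `h`. -/
def hbar : WeylSeries := mk fun k => if k = 1 then 1 else 0

lemma hbar_apply (k : ℕ) : hbar k = if k = 1 then 1 else 0 := rfl

lemma hbar_mul_zero (a : WeylSeries) : (hbar * a) 0 = 0 := by
  simp [mul_apply_zero, hbar_apply]

lemma hbar_mul_succ (a : WeylSeries) (k : ℕ) : (hbar * a) (k + 1) = a k := by
  have : ∀ n l x, bidiff n (hbar l) x = if n = 0 ∧ l = 1 then x else 0 := fun n l x => by
    by_cases hl : l = 1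
    · simp [hl, hbar_apply, bidiff_one_left]
    · simp [hl, hbar_apply, bidiff_zero_left]
  simp only [mul_apply, this]
  rw [Finset.Nat.sum_antidiagonal_succ]
  simp only [true_and, Nat.succ_ne_zero, false_and, if_false, sum_const_zero, add_zero]
  rw [Finset.Nat.sum_antidiagonal_succ]
  cases k <;> simp [Finset.Nat.sum_antidiagonal_succ]

lemma hbar_comm (a : WeylSeries) : hbar * a = a * hbar := by
  ext1 k
  simp only [mul_apply]
  refine sum_congr rfl fun d _ => ?_
  rw [← Finset.Nat.sum_antidiagonal_swap]
  refine sum_congr rfl fun t _ => ?_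
  simp only [Prod.fst_swap, Prod.snd_swap]
  rw [bidiff_symm, hbar_apply]
  by_cases hl : t.2 = 1
  · rcases d.1.eq_zero_or_pos with h | h
    · simp [h, hl]
    · simp [hl, bidiff_one_right, h.ne']
  · simp [hl, bidiff_zero_right]

/-- Division by `h`, dropping the coefficient of `h ^ 0`. -/
def divH (a : WeylSeries) : WeylSeries := mk fun k => a (k + 1)

lemma divH_apply (a : WeylSeries) (k : ℕ) : divH a k = a (k + 1) := rfl

lemma hbar_mul_divH {a : WeylSeries} (h : a 0 = 0) : hbar * divH a = a := by
  ext1 k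
  cases k with
  | zero => rw [hbar_mul_zero, h]
  | succ k => rw [hbar_mul_succ, divH_apply]

lemma degreeIn_hbar : DegreeIn {0} hbar := by
  intro k m n
  rw [hbar_apply]
  split_ifs
  · rw [cf_one]; split_ifs with h <;> simp [h]
  · simp

/-- The symbol `z ζ`. -/
def osc : WeylSeries := const (ofCf fun m n => if m = 1 ∧ n = 1 then 1 else 0)

lemma degreeIn_osc : DegreeIn {0} osc := by
  intro k m n
  rw [osc, const_apply]
  split_ifs
  · rw [cf_ofCf]; split_ifs with h <;> simp [h]
  · simp

/-- The derivation `z ∂_z - ζ ∂_ζ`. -/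
def rot : WeylSeries →ₗ[ℂ] WeylSeries := mult fun i => (i.2.1 : ℂ) - i.2.2

/-- In a commutator the even orders cancel by `bidiff_symm`, and orders at least 3 vanish because zζ
is quadratic. Only the Poisson bracket is left, so the formula is exact in h. -/
lemma osc_mul_sub_mul_osc (a : WeylSeries) :
    osc * a - a * osc = hbar * ((-Complex.I) • rot a) := by
  set p : DoubleSeries := ofCf fun m n => if m = 1 ∧ n = 1 then 1 else 0 with hp
  set x : DoubleSeries := ofCf fun m n => if m = 1 ∧ n = 0 then 1 else 0 with hx
  set y : DoubleSeries := ofCf fun m n => if m = 0 ∧ n = 1 then 1 else 0 with hy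
  have hpz : dz p = y := DoubleSeries.ext_cf fun m n => by
    rw [cf_dz, hp, hy, cf_ofCf, cf_ofCf]; rcases eq_or_ne m 0 with rfl | h <;> simp_all
  have hpζ : dζ p = x := DoubleSeries.ext_cf fun m n => by
    rw [cf_dζ, hp, hx, cf_ofCf, cf_ofCf]; rcases eq_or_ne n 0 with rfl | h <;> simp_all
  have hxz : dz x = 1 := DoubleSeries.ext_cf fun m n => by
    rw [cf_dz, hx, cf_one, cf_ofCf]; rcases eq_or_ne m 0 with rfl | h <;> simp_all
  have hxζ : dζ x = 0 := DoubleSeries.ext_cf fun m n => by rw [cf_dζ, hx, cf_ofCf]; simp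
  have hyζ : dζ y = 1 := DoubleSeries.ext_cf fun m n => by
    rw [cf_dζ, hy, cf_one, cf_ofCf]; rcases eq_or_ne n 0 with rfl | h <;> simp_all
  have hyz : dz y = 0 := DoubleSeries.ext_cf fun m n => by rw [cf_dz, hy, cf_ofCf]; simp
  have hX : x = PowerSeries.X := DoubleSeries.ext_cf fun m n => by
    rw [hx, cf_ofCf, cf, PowerSeries.coeff_X]
    rcases eq_or_ne m 1 with rfl | h <;> simp_all [PowerSeries.coeff_one]
  have hY : y = PowerSeries.C PowerSeries.X := DoubleSeries.ext_cf fun m n => by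
    rw [hy, cf_ofCf, cf, PowerSeries.coeff_C]
    rcases eq_or_ne m 0 with rfl | h <;> simp_all [PowerSeries.coeff_X]
  have b2x : ∀ n g, bidiff (n + 2) x g = 0 := fun n g => by
    apply smul_cast_succ_injective (n + 1)
    rw [bidiff_succ, hxz, hxζ]
    simp [bidiff_zero_left, bidiff_one_left]
  have b2y : ∀ n g, bidiff (n + 2) y g = 0 := fun n g => by
    apply smul_cast_succ_injective (n + 1)
    rw [bidiff_succ, hyz, hyζ]
    simp [bidiff_zero_left, bidiff_one_left]
  have b3 : ∀ n g, bidiff (n + 3) p g = 0 := fun n g => by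
    apply smul_cast_succ_injective (n + 2)
    rw [bidiff_succ, hpz, hpζ, b2x, b2y]
    simp
  have b1 : ∀ g, bidiff 1 p g = (2 * Complex.I)⁻¹ • (x * dz g - y * dζ g) := fun g => by
    have := bidiff_succ 0 p g
    simpa [hpz, hpζ, bidiff_zero] using this
  have hcomm : ∀ n g, bidiff n p g - bidiff n g p =
      if n = 1 then (-Complex.I) • (x * dz g - y * dζ g) else 0 := by
    intro n g
    rw [bidiff_symm n g p]
    match n with
    | 0 => simp
    | 1 =>
      rw [b1]
      have : (2 * Complex.I)⁻¹ = -Complex.I / 2 := by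
        rw [mul_inv, Complex.inv_I]; ring
      rw [this]
      simp only [if_true, pow_one]
      module
    | 2 => simp
    | n + 3 => simp [b3]
  have hrot : ∀ g : DoubleSeries, ∀ m n, cf (x * dz g - y * dζ g) m n = ((m : ℂ) - n) * cf g m n := by
    intro g m n
    have h1 : cf (x * dz g) m n = m * cf g m n := by
      cases m with
      | zero => simp [hX, cf]
      | succ m =>
        rw [hX, cf, PowerSeries.coeff_succ_X_mul]
        exact (cf_dz g m n).trans (by push_cast; rfl)
    have h2 : cf (y * dζ g) m n = n * cf g m n := by
      rw [hY, cf, PowerSeries.coeff_C_mul]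
      cases n with
      | zero => simp
      | succ n =>
        rw [PowerSeries.coeff_succ_X_mul]
        exact (cf_dζ g m n).trans (by push_cast; rfl)
    rw [cf_sub, h1, h2]; ring
  ext1 k
  rw [sub_apply, osc, const_mul_apply, mul_const_apply, ← sum_sub_distrib]
  simp only [← hp, hcomm]
  cases k with
  | zero => rw [hbar_mul_zero]; simp
  | succ k =>
    rw [hbar_mul_succ, Finset.Nat.sum_antidiagonal_succ]
    have : ∑ d ∈ antidiagonal k, (if d.1 + 1 = 1 then
        (-Complex.I) • (x * dz (a d.2) - y * dζ (a d.2)) else 0) =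
        (-Complex.I) • (x * dz (a k) - y * dζ (a k)) := by
      cases k <;> simp [Finset.Nat.sum_antidiagonal_succ]
    simp only [this, zero_ne_one, if_false, zero_add]
    apply DoubleSeries.ext_cf
    intro m n
    rw [smul_apply, cf_smul, hrot, cf_smul, rot, cf_mult]

end WeylSeries
end AnalyticSymbols

/-! ### The Boutet de Monvel–Krée norm and its submultiplicativity -/

namespace AnalyticSymbols

open Finset PowerSeries DoubleSeries
open scoped ENNReal Nat

lemma ENNReal_tsum_antidiagonal (f : ℕ × ℕ → ℝ≥0∞) :
    ∑' k, ∑ p ∈ antidiagonal k, f p = ∑' p, f p := by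
  rw [← Finset.HasAntidiagonal.sigmaAntidiagonalEquivProd.tsum_eq, ENNReal.tsum_sigma']
  refine tsum_congr fun k => ?_
  rw [tsum_fintype, Finset.sum_coe_sort_eq_attach, ← Finset.sum_attach]
  rfl

lemma ENNReal_tsum_finsetSum {ι κ : Type*} (s : Finset ι) (f : κ → ι → ℝ≥0∞) :
    ∑' k, ∑ i ∈ s, f k i = ∑ i ∈ s, ∑' k, f k i :=
  Summable.tsum_finsetSum fun _ _ => ENNReal.summable

lemma ENNReal_tsum_antidiagonal₂ (f : ℕ × ℕ → ℕ × ℕ → ℝ≥0∞) :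
    ∑' m, ∑' n, ∑ i ∈ antidiagonal m, ∑ j ∈ antidiagonal n, f i j = ∑' i, ∑' j, f i j := by
  simp only [ENNReal_tsum_finsetSum, ENNReal_tsum_antidiagonal]

/-- In binomial form this bounds one summand of Vandermonde's convolution by the whole sum. -/
lemma factorial_vandermonde (i i' j j' : ℕ) :
    (i + i')! * (j + j')! * (i + j)! * (i' + j')! ≤
      i ! * i' ! * j ! * j' ! * (i + i' + j + j')! := by
  have h1 : (i + i').choose i * (j + j').choose j ≤ (i + i' + (j + j')).choose (i + j) := by
    rw [Nat.add_choose_eq (i + i') (j + j')]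
    exact Finset.single_le_sum (f := fun p : ℕ × ℕ => (i + i').choose p.1 * (j + j').choose p.2)
      (fun _ _ => Nat.zero_le _) (a := (i, j)) (HasAntidiagonal.mem_antidiagonal.2 rfl)
  have e1 := Nat.add_choose_mul_factorial_mul_factorial i i'
  have e2 := Nat.add_choose_mul_factorial_mul_factorial j j'
  have e3 := Nat.add_choose_mul_factorial_mul_factorial (i + j) (i' + j')
  rw [show i + i' + (j + j') = (i + j) + (i' + j') by ring, Nat.choose_symm_add,
    Nat.choose_symm_add (a := j), Nat.choose_symm_add (a := i + j)] at h1
  rw [show i + i' + j + j' = (i + j) + (i' + j') by ring, ← e3, ← e1, ← e2]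
  calc _ = ((i + i').choose i' * (j + j').choose j') *
        (i ! * i' ! * j ! * j' ! * (i + j)! * (i' + j')!) := by ring
    _ ≤ _ := Nat.mul_le_mul_right _ h1
    _ = _ := by ring

/-- The weights of the Boutet de Monvel–Krée norm. -/
def bk (k m n : ℕ) : ℝ := (k ! * m ! * n !) / ((k + m)! * (k + n)!)

lemma bk_pos (k m n : ℕ) : 0 < bk k m n := by unfold bk; positivity

/-- The weights are designed so that the factors produced by differentiating monomials, divided by
α! β!, are absorbed exactly. Cleared of denominators, the inequality is a combination of three
Vandermonde bounds: one for the z-exponents, one for the ζ-exponents, one for the powers of h. -/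
lemma bk_mul_le (k k' α β μ μ' ν ν' : ℕ) :
    bk (α + β + (k + k')) (μ + μ') (ν + ν') * ((α ! : ℝ) * β !)⁻¹ *
      (((μ + 1).ascFactorial β * (ν + 1).ascFactorial α : ℝ) *
        ((μ' + 1).ascFactorial α * (ν' + 1).ascFactorial β)) ≤
    bk k (μ + β) (ν + α) * bk k' (μ' + α) (ν' + β) := by
  have asc : ∀ m a : ℕ, ((m + 1).ascFactorial a : ℝ) = (m + a)! / m ! := fun m a => by
    rw [eq_div_iff (by positivity), mul_comm]
    exact_mod_cast Nat.factorial_mul_ascFactorial m a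
  have V1 := factorial_vandermonde (k + β) (k' + α) μ μ'
  have V2 := factorial_vandermonde (k + α) (k' + β) ν ν'
  have V3 := factorial_vandermonde k β α k'
  have e1 : k + β + (k' + α) = α + β + (k + k') := by ring
  have e2 : k + α + (k' + β) = α + β + (k + k') := by ring
  have e3 : k + β + α + k' = α + β + (k + k') := by ring
  rw [e1] at V1
  rw [e2] at V2
  rw [e3] at V3
  rw [add_comm α k', add_comm β k'] at V3
  set J := α + β + (k + k')
  have key : J ! * (μ + μ')! * (ν + ν')! * (k + β + μ)! * (k' + α + μ')! * (k + α + ν)! *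
      (k' + β + ν')! ≤ k ! * k' ! * α ! * β ! * μ ! * μ' ! * ν ! * ν' ! * (J + μ + μ')! *
      (J + ν + ν')! := by
    refine Nat.le_of_mul_le_mul_left ?_ (Nat.factorial_pos J)
    calc _ = (J ! * (μ + μ')! * (k + β + μ)! * (k' + α + μ')!) *
          (J ! * (ν + ν')! * (k + α + ν)! * (k' + β + ν')!) := by ring
      _ ≤ _ := Nat.mul_le_mul V1 V2
      _ = ((k + β)! * (k' + α)! * (k + α)! * (k' + β)!) *
          (μ ! * μ' ! * ν ! * ν' ! * (J + μ + μ')! * (J + ν + ν')!) := by ring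
      _ ≤ _ := Nat.mul_le_mul_right _ V3
      _ = _ := by ring
  have key' : (J ! * (μ + μ')! * (ν + ν')! * (k + β + μ)! * (k' + α + μ')! * (k + α + ν)! *
      (k' + β + ν')! : ℝ) ≤ k ! * k' ! * α ! * β ! * μ ! * μ' ! * ν ! * ν' ! * (J + μ + μ')! *
      (J + ν + ν')! := by exact_mod_cast key
  simp only [asc, bk]
  rw [show k + (μ + β) = k + β + μ by ring, show k + (ν + α) = k + α + ν by ring,
    show k' + (μ' + α) = k' + α + μ' by ring, show k' + (ν' + β) = k' + β + ν' by ring,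
    ← add_assoc J, ← add_assoc J]
  have hc : (0 : ℝ) < (μ + β)! * (ν + α)! * (μ' + α)! * (ν' + β)! /
    (α ! * β ! * μ ! * μ' ! * ν ! * ν' ! * (J + μ + μ')! * (J + ν + ν')! *
     (k + β + μ)! * (k' + α + μ')! * (k + α + ν)! * (k' + β + ν')!) := by positivity
  refine le_of_eq_of_le ?_ ((mul_le_mul_of_nonneg_left key' hc.le).trans_eq ?_) <;> field_simp

namespace WeylSeries

/-- The weights of the norm. -/
def wt (k m n : ℕ) : ℝ≥0∞ := ENNReal.ofReal (4 * bk k m n)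

lemma wt_pos (k m n : ℕ) : 0 < wt k m n :=
  ENNReal.ofReal_pos.2 (by have := bk_pos k m n; positivity)

lemma wt_ne_top (k m n : ℕ) : wt k m n ≠ ∞ := ENNReal.ofReal_ne_top

/-- The Boutet de Monvel–Krée norm of a formal symbol, possibly infinite. -/
def nrm (a : WeylSeries) : ℝ≥0∞ := ∑' k, ∑' m, ∑' n, wt k m n * ‖cf (a k) m n‖ₑ

/-- For fixed (α, β), `bk_mul_le` bounds the contribution by a product of two sums over shifted
exponents, each at most the full norm. The powers of 2 in the Weyl coefficients make the remaining
sum over (α, β) geometric. -/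
lemma nrm_mul_le (a b : WeylSeries) : nrm (a * b) ≤ nrm a * nrm b := by
  set A : ℕ → ℕ → ℕ → ℝ≥0∞ := fun k m n => wt k m n * ‖cf (a k) m n‖ₑ with hA
  set B : ℕ → ℕ → ℕ → ℝ≥0∞ := fun k m n => wt k m n * ‖cf (b k) m n‖ₑ with hB
  -- The sum of 2^(-α-β) over (α, β) is 4. The factor 4 in `wt`, which occurs once on the left and
  -- twice on the right, contributes the 4⁻¹ that normalises the total of `D` to 1.
  set D : ℕ × ℕ → ℝ≥0∞ := fun s => 4⁻¹ * (2⁻¹ ^ s.1 * 2⁻¹ ^ s.2) with hD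
  have term : ∀ s t i j : ℕ × ℕ, wt (s.1 + s.2 + (t.1 + t.2)) (i.1 + i.2) (j.1 + j.2) * ‖wc s *
        (((i.1 + 1).ascFactorial s.2 * (j.1 + 1).ascFactorial s.1 *
          cf (a t.1) (i.1 + s.2) (j.1 + s.1)) *
        ((i.2 + 1).ascFactorial s.1 * (j.2 + 1).ascFactorial s.2 *
          cf (b t.2) (i.2 + s.1) (j.2 + s.2)))‖ₑ ≤
      D s * (A t.1 (i.1 + s.2) (j.1 + s.1) * B t.2 (i.2 + s.1) (j.2 + s.2)) := by
    intro s t i j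
    have hD' : D s = ENNReal.ofReal (4⁻¹ * (2⁻¹ ^ s.1 * 2⁻¹ ^ s.2)) := by
      rw [hD, ENNReal.ofReal_mul (by norm_num), ENNReal.ofReal_mul (by positivity),
        ENNReal.ofReal_pow (by norm_num), ENNReal.ofReal_pow (by norm_num),
        ENNReal.ofReal_inv_of_pos (by norm_num), ENNReal.ofReal_inv_of_pos (by norm_num)]
      simp
    have p1 := bk_pos (s.1 + s.2 + (t.1 + t.2)) (i.1 + i.2) (j.1 + j.2)
    have p2 := bk_pos t.1 (i.1 + s.2) (j.1 + s.1)
    have p3 := bk_pos t.2 (i.2 + s.1) (j.2 + s.2)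
    simp only [hA, hB, wt, hD', ← ofReal_norm]
    rw [← ENNReal.ofReal_mul (by positivity), ← ENNReal.ofReal_mul (by positivity),
      ← ENNReal.ofReal_mul (by positivity), ← ENNReal.ofReal_mul (by positivity),
      ← ENNReal.ofReal_mul (by positivity)]
    apply ENNReal.ofReal_le_ofReal
    have hw : ‖wc s‖ = (2⁻¹ ^ s.1 * 2⁻¹ ^ s.2) * ((s.1 ! : ℝ) * s.2 !)⁻¹ := by
      simp only [wc, norm_div, norm_mul, norm_pow, norm_neg, norm_one, one_pow, Complex.norm_ofNat,
        Complex.norm_I, Complex.norm_natCast, mul_one, pow_add, inv_pow]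
      field_simp
    have := mul_le_mul_of_nonneg_left (bk_mul_le t.1 t.2 s.1 s.2 i.1 i.2 j.1 j.2)
      (by positivity : 0 ≤ 4 * (2⁻¹ ^ s.1 * 2⁻¹ ^ s.2) * ‖cf (a t.1) (i.1 + s.2) (j.1 + s.1)‖ *
        ‖cf (b t.2) (i.2 + s.1) (j.2 + s.2)‖)
    simp only [norm_mul, hw, Complex.norm_natCast]
    refine le_of_eq_of_le ?_ (this.trans_eq ?_) <;> ring
  calc nrm (a * b)
      ≤ ∑' k, ∑' m, ∑' n, ∑ d ∈ antidiagonal k, ∑ t ∈ antidiagonal d.2, ∑ s ∈ antidiagonal d.1,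
          ∑ i ∈ antidiagonal m, ∑ j ∈ antidiagonal n,
          D s * (A t.1 (i.1 + s.2) (j.1 + s.1) * B t.2 (i.2 + s.1) (j.2 + s.2)) := by
        refine ENNReal.tsum_le_tsum fun k => ENNReal.tsum_le_tsum fun m =>
          ENNReal.tsum_le_tsum fun n => ?_
        rw [cf_mul]
        refine (mul_le_mul_right ((enorm_sum_le _ _).trans (sum_le_sum fun d hd =>
          (enorm_sum_le _ _).trans (sum_le_sum fun t ht =>
          (enorm_sum_le _ _).trans (sum_le_sum fun s hs =>
          (enorm_sum_le _ _).trans (sum_le_sum fun i hi =>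
          (enorm_sum_le _ _)))))) _).trans ?_
        simp only [Finset.mul_sum]
        refine sum_le_sum fun d hd => sum_le_sum fun t ht => sum_le_sum fun s hs =>
          sum_le_sum fun i hi => sum_le_sum fun j hj => ?_
        rw [HasAntidiagonal.mem_antidiagonal] at hd ht hs hi hj
        rw [← hi, ← hj, ← hd, ← hs, ← ht]
        exact term s t i j
    _ = ∑' k, ∑ d ∈ antidiagonal k, ∑ t ∈ antidiagonal d.2, ∑ s ∈ antidiagonal d.1,
          ∑' i : ℕ × ℕ, ∑' j : ℕ × ℕ,
          D s * (A t.1 (i.1 + s.2) (j.1 + s.1) * B t.2 (i.2 + s.1) (j.2 + s.2)) := by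
        simp only [← ENNReal_tsum_antidiagonal₂]
        simp only [ENNReal_tsum_finsetSum]
    _ = ∑' s : ℕ × ℕ, ∑' t : ℕ × ℕ, ∑' i : ℕ × ℕ, ∑' j : ℕ × ℕ,
          D s * (A t.1 (i.1 + s.2) (j.1 + s.1) * B t.2 (i.2 + s.1) (j.2 + s.2)) := by
        rw [ENNReal_tsum_antidiagonal (fun d => ∑ t ∈ antidiagonal d.2, ∑ s ∈ antidiagonal d.1,
          ∑' i : ℕ × ℕ, ∑' j : ℕ × ℕ,
          D s * (A t.1 (i.1 + s.2) (j.1 + s.1) * B t.2 (i.2 + s.1) (j.2 + s.2))),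
          ENNReal.tsum_prod', ← ENNReal_tsum_antidiagonal₂]
        exact tsum_congr fun _ => tsum_congr fun _ => Finset.sum_comm
    _ = ∑' s : ℕ × ℕ, D s * ((∑' k, ∑' m, ∑' n, A k (m + s.2) (n + s.1)) *
          ∑' k, ∑' m, ∑' n, B k (m + s.1) (n + s.2)) := by
        refine tsum_congr fun s => ?_
        simp only [ENNReal.tsum_prod', ENNReal.tsum_mul_left, ENNReal.tsum_mul_right]
    _ ≤ ∑' s : ℕ × ℕ, D s * (nrm a * nrm b) := by
        refine ENNReal.tsum_le_tsum fun s => ?_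
        gcongr
        · refine ENNReal.tsum_le_tsum fun k => ?_
          refine le_trans (ENNReal.tsum_le_tsum fun m => ?_)
            (ENNReal.tsum_comp_le_tsum_of_injective (add_left_injective s.2) _)
          exact ENNReal.tsum_comp_le_tsum_of_injective (add_left_injective s.1) _
        · refine ENNReal.tsum_le_tsum fun k => ?_
          refine le_trans (ENNReal.tsum_le_tsum fun m => ?_)
            (ENNReal.tsum_comp_le_tsum_of_injective (add_left_injective s.1) _)
          exact ENNReal.tsum_comp_le_tsum_of_injective (add_left_injective s.2) _
    _ = nrm a * nrm b := by
        rw [ENNReal.tsum_mul_right]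
        have : ∑' s, D s = 1 := by
          rw [ENNReal.tsum_prod']
          simp only [hD, ENNReal.tsum_mul_left, ENNReal.tsum_mul_right, ENNReal.tsum_geometric]
          rw [ENNReal.one_sub_inv_two, inv_inv]
          rw [show (2 : ℝ≥0∞) * 2 = 4 by norm_num]
          exact ENNReal.inv_mul_cancel (by norm_num) (by norm_num)
        rw [this, one_mul]

end WeylSeries
end AnalyticSymbols

/-! ### The Banach algebra of symbols of finite norm -/

namespace AnalyticSymbols

open Finset PowerSeries DoubleSeries
open scoped ENNReal Nat

namespace WeylSeries

lemma nrm_add_le (a b : WeylSeries) : nrm (a + b) ≤ nrm a + nrm b := by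
  simp only [nrm, ← ENNReal.tsum_add, ← mul_add, add_apply, cf_add]
  gcongr
  exact enorm_add_le _ _

lemma nrm_smul (c : ℂ) (a : WeylSeries) : nrm (c • a) = ‖c‖ₑ * nrm a := by
  simp only [nrm, ← ENNReal.tsum_mul_left, smul_apply, cf_smul, enorm_mul]
  simp only [mul_left_comm]

lemma nrm_mono {a b : WeylSeries} (h : ∀ k m n, ‖cf (a k) m n‖ ≤ ‖cf (b k) m n‖) :
    nrm a ≤ nrm b := by
  simp only [nrm]
  gcongr
  rw [enorm_le_iff_norm_le]
  exact h _ _ _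

lemma wt_mul_enorm_le_nrm (a : WeylSeries) (k m n : ℕ) : wt k m n * ‖cf (a k) m n‖ₑ ≤ nrm a :=
  ((ENNReal.le_tsum (f := fun n => wt k m n * ‖cf (a k) m n‖ₑ) n).trans
    (ENNReal.le_tsum (f := fun m => ∑' n, wt k m n * ‖cf (a k) m n‖ₑ) m)).trans
    (ENNReal.le_tsum (f := fun k => ∑' m, ∑' n, wt k m n * ‖cf (a k) m n‖ₑ) k)

lemma nrm_eq_zero {a : WeylSeries} (h : nrm a = 0) : a = 0 := by
  refine ext_cf fun k m n => ?_
  have := wt_mul_enorm_le_nrm a k m n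
  rw [h, nonpos_iff_eq_zero, mul_eq_zero] at this
  rw [zero_apply, cf_zero]
  simpa using this.resolve_left (wt_pos k m n).ne'

lemma nrm_of_monomial {a : WeylSeries} (k₀ m₀ n₀ : ℕ)
    (h : ∀ k m n, ¬ (k = k₀ ∧ m = m₀ ∧ n = n₀) → cf (a k) m n = 0) :
    nrm a = wt k₀ m₀ n₀ * ‖cf (a k₀) m₀ n₀‖ₑ := by
  rw [nrm, tsum_eq_single k₀, tsum_eq_single m₀, tsum_eq_single n₀]
  · intro n hn; rw [h _ _ _ (by tauto)]; simp
  · intro m hm; simp only [h _ m _ fun hh => hm hh.2.1, enorm_zero, mul_zero, tsum_zero]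
  · intro k hk; simp only [h k _ _ fun hh => hk hh.1, enorm_zero, mul_zero, tsum_zero]

lemma nrm_of_monomial_lt_top {a : WeylSeries} (k₀ m₀ n₀ : ℕ)
    (h : ∀ k m n, ¬ (k = k₀ ∧ m = m₀ ∧ n = n₀) → cf (a k) m n = 0) : nrm a < ∞ := by
  rw [nrm_of_monomial k₀ m₀ n₀ h]
  exact ENNReal.mul_lt_top (wt_ne_top _ _ _).lt_top enorm_lt_top

lemma nrm_one_lt_top : nrm 1 < ∞ :=
  nrm_of_monomial_lt_top 0 0 0 fun k m n h => by
    rw [one_apply]; split_ifs with hk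
    · rw [cf_one, if_neg (by tauto)]
    · simp

lemma nrm_hbar_lt_top : nrm hbar < ∞ :=
  nrm_of_monomial_lt_top 1 0 0 fun k m n h => by
    rw [hbar_apply]; split_ifs with hk
    · rw [cf_one, if_neg (by tauto)]
    · simp

lemma nrm_osc_lt_top : nrm osc < ∞ :=
  nrm_of_monomial_lt_top 0 1 1 fun k m n h => by
    rw [osc, const_apply]; split_ifs with hk
    · rw [cf_ofCf, if_neg (by tauto)]
    · simp

/-- Lowering k by one raises the weight by the factor (k+m+1)(k+n+1)/(k+1), which is unbounded but
polynomial; the dilation by 1/2 gains 2^(-(2k+m+n)), and this outweighs it. -/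
lemma nrm_divH_le (a : WeylSeries) : nrm (scale (1 / 2) (divH a)) ≤ nrm a := by
  have hw : ∀ k m n : ℕ, bk k m n * (1 / 2) ^ (2 * k + m + n) ≤ bk (k + 1) m n := by
    intro k m n
    have e1 : (k + 1 + m)! = (k + m + 1) * (k + m)! := by
      rw [show k + 1 + m = k + m + 1 by ring, Nat.factorial_succ]
    have e2 : (k + 1 + n)! = (k + n + 1) * (k + n)! := by
      rw [show k + 1 + n = k + n + 1 by ring, Nat.factorial_succ]
    have key : ((k + m + 1) * (k + n + 1) : ℝ) ≤ 2 ^ (2 * k + m + n) := by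
      have h1 : k + m + 1 ≤ 2 ^ (k + m) := Nat.lt_two_pow_self
      have h2 : k + n + 1 ≤ 2 ^ (k + n) := Nat.lt_two_pow_self
      have h3 := Nat.mul_le_mul h1 h2
      rw [← pow_add, show k + m + (k + n) = 2 * k + m + n by ring] at h3
      exact_mod_cast h3
    have hk : (k + m + 1) * (k + n + 1) ≤ ((k : ℝ) + 1) * 2 ^ (2 * k + m + n) := by
      have : (0 : ℝ) ≤ k * 2 ^ (2 * k + m + n) := by positivity
      linarith
    unfold bk
    rw [e1, e2, Nat.factorial_succ, one_div, inv_pow, ← div_eq_mul_inv, div_div,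
      div_le_div_iff₀ (by positivity) (by positivity)]
    push_cast
    have := mul_le_mul_of_nonneg_left hk
      (by positivity : (0 : ℝ) ≤ k ! * m ! * n ! * (k + m)! * (k + n)!)
    linarith
  calc nrm (scale (1 / 2) (divH a))
      ≤ ∑' k, ∑' m, ∑' n, wt (k + 1) m n * ‖cf (a (k + 1)) m n‖ₑ := by
        simp only [nrm, cf_scale, divH_apply, enorm_mul, ← mul_assoc]
        gcongr with k m n
        rw [wt, wt, ← ofReal_norm, ← ENNReal.ofReal_mul (by have := bk_pos k m n; positivity)]
        apply ENNReal.ofReal_le_ofReal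
        have := hw k m n
        rw [norm_pow, norm_div, norm_one, Complex.norm_ofNat]
        linarith
    _ ≤ nrm a := ENNReal.tsum_comp_le_tsum_of_injective (add_left_injective 1)
        fun k => ∑' m, ∑' n, wt k m n * ‖cf (a k) m n‖ₑ

end WeylSeries

open WeylSeries

/-- The formal symbols of finite norm. -/
def weylSubalgebra : Subalgebra ℂ WeylSeries where
  carrier := {a | nrm a < ∞}
  mul_mem' {a b} ha hb := (nrm_mul_le a b).trans_lt (ENNReal.mul_lt_top ha hb)
  one_mem' := nrm_one_lt_top
  add_mem' {a b} ha hb := (nrm_add_le a b).trans_lt (ENNReal.add_lt_top.2 ⟨ha, hb⟩)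
  zero_mem' := by
    have := nrm_smul 0 0
    simp_all
  algebraMap_mem' c := by
    rw [Algebra.algebraMap_eq_smul_one]
    exact (nrm_smul c 1).trans_lt (ENNReal.mul_lt_top enorm_lt_top nrm_one_lt_top)

/-- The norm on the formal symbols of finite norm. -/
def weylNorm : AddGroupNorm weylSubalgebra where
  toFun a := (nrm a.1).toReal
  map_zero' := by
    have := nrm_smul 0 0
    simp_all
  add_le' a b := by
    rw [← ENNReal.toReal_add a.2.ne b.2.ne]
    exact ENNReal.toReal_mono (ENNReal.add_ne_top.2 ⟨a.2.ne, b.2.ne⟩) (nrm_add_le _ _)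
  neg' a := by
    have := nrm_smul (-1) a.1
    rw [neg_one_smul] at this
    simp [this]
  eq_zero_of_map_eq_zero' a h := by
    rw [ENNReal.toReal_eq_zero_iff] at h
    exact Subtype.ext (nrm_eq_zero (h.resolve_right a.2.ne))

/-- The formal symbols of finite norm as a normed ring. -/
abbrev weylNormedRing : NormedRing weylSubalgebra where
  __ := weylNorm.toNormedAddCommGroup
  __ := (inferInstance : Ring weylSubalgebra)
  norm_mul_le a b := by
    change (nrm (a * b).1).toReal ≤ (nrm a.1).toReal * (nrm b.1).toReal
    rw [← ENNReal.toReal_mul]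
    exact ENNReal.toReal_mono (ENNReal.mul_ne_top a.2.ne b.2.ne) (nrm_mul_le _ _)

/-- The Banach algebra of symbols of finite norm. -/
structure WeylAlgebra where
  /-- The underlying formal symbol. -/
  val : WeylSeries
  nrm_lt_top : nrm val < ∞

namespace WeylAlgebra

/-- The identification with a subalgebra of the formal symbols. -/
def equivSubalgebra : WeylAlgebra ≃ weylSubalgebra :=
  ⟨fun a => ⟨a.1, a.2⟩, fun a => ⟨a.1, a.2⟩, fun _ => rfl, fun _ => rfl⟩

instance : Ring WeylAlgebra := equivSubalgebra.ring

instance : Algebra ℂ WeylAlgebra := equivSubalgebra.algebra ℂ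

instance : NormedRing WeylAlgebra :=
  let _ : NormedRing weylSubalgebra := weylNormedRing
  NormedRing.induced WeylAlgebra weylSubalgebra equivSubalgebra.ringEquiv
    equivSubalgebra.injective

@[ext] lemma ext {a b : WeylAlgebra} (h : a.1 = b.1) : a = b := by
  cases a; cases b; congr

lemma norm_def (a : WeylAlgebra) : ‖a‖ = (nrm a.1).toReal := rfl

lemma ofReal_norm_eq (a : WeylAlgebra) : ENNReal.ofReal ‖a‖ = nrm a.1 :=
  ENNReal.ofReal_toReal a.2.ne

lemma norm_le_iff (a : WeylAlgebra) {C : ℝ} (hC : 0 ≤ C) :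
    ‖a‖ ≤ C ↔ nrm a.1 ≤ ENNReal.ofReal C := by
  rw [← ofReal_norm_eq, ENNReal.ofReal_le_ofReal_iff hC]

instance : NormedAlgebra ℂ WeylAlgebra where
  norm_smul_le c a := by
    rw [norm_def, norm_def, ← toReal_enorm, ← ENNReal.toReal_mul]
    exact (congrArg ENNReal.toReal (nrm_smul c a.1)).le

lemma coe_add (a b : WeylAlgebra) : (a + b).1 = a.1 + b.1 := rfl
lemma coe_sub (a b : WeylAlgebra) : (a - b).1 = a.1 - b.1 := rfl
lemma coe_mul (a b : WeylAlgebra) : (a * b).1 = a.1 * b.1 := rfl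
lemma coe_one : (1 : WeylAlgebra).1 = 1 := rfl
lemma coe_smul (c : ℂ) (a : WeylAlgebra) : (c • a).1 = c • a.1 := rfl

lemma coe_pow (a : WeylAlgebra) (n : ℕ) : (a ^ n).1 = a.1 ^ n := by
  induction n with
  | zero => rw [pow_zero, pow_zero, coe_one]
  | succ n ih => rw [pow_succ, pow_succ, coe_mul, ih]

lemma norm_cf_le (a : WeylAlgebra) (k m n : ℕ) :
    ‖cf (a.1 k) m n‖ ≤ (4 * bk k m n)⁻¹ * ‖a‖ := by
  have hb := bk_pos k m n
  have h := ENNReal.toReal_mono a.2.ne (wt_mul_enorm_le_nrm a.1 k m n)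
  rw [ENNReal.toReal_mul, toReal_enorm, wt, ENNReal.toReal_ofReal (by positivity)] at h
  rw [inv_mul_eq_div, le_div_iff₀ (by positivity), mul_comm]
  exact h

/-- The coefficient of `h ^ k z ^ m ζ ^ n` as a continuous linear functional. -/
def coefL (k m n : ℕ) : WeylAlgebra →L[ℂ] ℂ :=
  LinearMap.mkContinuous
    { toFun := fun a => cf (a.1 k) m n
      map_add' := fun a b => by
        rw [coe_add, add_apply, cf_add]
      map_smul' := fun c a => by
        rw [coe_smul, smul_apply, cf_smul]; rfl }
    (4 * bk k m n)⁻¹ fun a => by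
      exact norm_cf_le a k m n

lemma coefL_apply (k m n : ℕ) (a : WeylAlgebra) : coefL k m n a = cf (a.1 k) m n := rfl

lemma ext_coefL {a b : WeylAlgebra} (h : ∀ k m n, coefL k m n a = coefL k m n b) : a = b :=
  WeylAlgebra.ext (WeylSeries.ext_cf fun k m n => by simpa only [coefL_apply] using h k m n)

/-- Coefficients are continuous functionals, so a Cauchy sequence has a coefficientwise limit. The
norm is a supremum of finite partial sums, so the Cauchy bounds pass to the limit as in Fatou's
lemma. -/
instance : CompleteSpace WeylAlgebra := by
  refine Metric.complete_of_cauchySeq_tendsto fun u hu => ?_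
  have hc : ∀ k m n, ∃ x, Filter.Tendsto (fun j => coefL k m n (u j)) Filter.atTop (nhds x) :=
    fun k m n => cauchySeq_tendsto_of_complete
      ((coefL k m n).uniformContinuous.comp_cauchySeq hu)
  choose x hx using hc
  set b : WeylSeries := WeylSeries.mk fun k => ofCf (x k) with hb
  have hbc : ∀ k m n, cf (b k) m n = x k m n := fun k m n => by
    rw [hb, mk_apply, cf_ofCf]
  have key : ∀ ε > 0, ∃ N, ∀ j ≥ N, nrm ((u j).1 - b) ≤ ENNReal.ofReal ε := by
    intro ε hε
    obtain ⟨N, hN⟩ := Metric.cauchySeq_iff.1 hu ε hε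
    refine ⟨N, fun j hj => ?_⟩
    have hT : ∀ a : WeylSeries, nrm a = ∑' i : ℕ × ℕ × ℕ,
        wt i.1 i.2.1 i.2.2 * ‖cf (a i.1) i.2.1 i.2.2‖ₑ := fun a => by
      rw [ENNReal.tsum_prod', nrm]
      exact tsum_congr fun k => by rw [ENNReal.tsum_prod']
    rw [hT, ENNReal.tsum_eq_iSup_sum]
    refine iSup_le fun s => ?_
    have hlim : Filter.Tendsto (fun l => ∑ i ∈ s,
        wt i.1 i.2.1 i.2.2 * ‖cf ((u j).1 i.1 - (u l).1 i.1) i.2.1 i.2.2‖ₑ) Filter.atTop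
        (nhds (∑ i ∈ s, wt i.1 i.2.1 i.2.2 * ‖cf (((u j).1 - b) i.1) i.2.1 i.2.2‖ₑ)) := by
      refine tendsto_finsetSum _ fun i _ => ?_
      refine ENNReal.Tendsto.const_mul ?_ (Or.inr (wt_ne_top _ _ _))
      refine (continuous_enorm.tendsto _).comp ?_
      simp only [cf_sub, sub_apply, hbc]
      exact tendsto_const_nhds.sub (hx _ _ _)
    refine le_of_tendsto hlim ?_
    filter_upwards [Filter.eventually_ge_atTop N] with l hl
    have h1 := (hN j hj l hl).le
    rw [dist_eq_norm, norm_le_iff _ hε.le] at h1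
    refine le_trans ?_ h1
    rw [coe_sub, hT]
    exact ENNReal.sum_le_tsum s
  obtain ⟨N, hN⟩ := key 1 one_pos
  have hmem : b ∈ weylSubalgebra := by
    have h1 : (u N).1 - b ∈ weylSubalgebra := (hN N le_rfl).trans_lt ENNReal.ofReal_lt_top
    have h2 := weylSubalgebra.sub_mem (u N).2 h1
    rwa [sub_sub_cancel] at h2
  refine ⟨⟨b, hmem⟩, Metric.tendsto_atTop.2 fun ε hε => ?_⟩
  obtain ⟨M, hM⟩ := key (ε / 2) (by positivity)
  refine ⟨M, fun j hj => ?_⟩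
  have h1 : ‖u j - ⟨b, hmem⟩‖ ≤ ε / 2 := by
    rw [norm_le_iff _ (by positivity), coe_sub]
    exact hM j hj
  rw [dist_eq_norm]
  exact h1.trans_lt (by linarith)

/-- Multiplication of the coefficients by `f`, where `|f| ≤ 1`. -/
def multL (f : ℕ × ℕ × ℕ → ℂ) (hf : ∀ i, ‖f i‖ ≤ 1) : WeylAlgebra →L[ℂ] WeylAlgebra :=
  have h (a : WeylSeries) : nrm (mult f a) ≤ nrm a := nrm_mono fun k m n => by
    rw [cf_mult, norm_mul]
    exact mul_le_of_le_one_left (norm_nonneg _) (hf _)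
  LinearMap.mkContinuous
    { toFun := fun a => ⟨mult f a.1, (h a.1).trans_lt a.2⟩
      map_add' := fun a b => WeylAlgebra.ext (map_add (mult f) a.1 b.1)
      map_smul' := fun c a => WeylAlgebra.ext (map_smul (mult f) c a.1) }
    1 fun a => by
      rw [one_mul, norm_le_iff _ (norm_nonneg _), ofReal_norm_eq]
      exact h a.1

lemma coe_multL (f : ℕ × ℕ × ℕ → ℂ) (hf : ∀ i, ‖f i‖ ≤ 1) (a : WeylAlgebra) :
    (multL f hf a).1 = mult f a.1 := rfl

/-- The symbol `h` as an element of `WeylAlgebra`. -/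
def hA : WeylAlgebra := ⟨hbar, nrm_hbar_lt_top⟩

/-- The symbol `z ζ` as an element of `WeylAlgebra`. -/
def oscA : WeylAlgebra := ⟨osc, nrm_osc_lt_top⟩

lemma hA_comm (a : WeylAlgebra) : hA * a = a * hA := WeylAlgebra.ext (hbar_comm a.1)

end WeylAlgebra
end AnalyticSymbols

/-! ### Local surjectivity in Banach algebras -/

namespace AnalyticSymbols

section BanachAlgebra

variable {A : Type*} [NormedRing A] [NormedAlgebra ℂ A]

lemma hasStrictFDerivAt_mul_of_zero {E : Type*} [NormedAddCommGroup E] [NormedSpace ℂ E]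
    {p q : E → A} {p' q' : E →L[ℂ] A} {x : E} (hp : HasStrictFDerivAt p p' x)
    (hq : HasStrictFDerivAt q q' x) (hp0 : p x = 0) (hq0 : q x = 0) :
    HasStrictFDerivAt (fun v => p v * q v) (0 : E →L[ℂ] A) x := by
  have := hp.mul' hq
  rw [hp0, hq0] at this
  have e : (0 : E →L[ℂ] A) = (0 : A) • q' + MulOpposite.op (0 : A) • p' := by
    refine ContinuousLinearMap.ext fun v => ?_
    change (0 : A) = (0 : A) • q' v + MulOpposite.op (0 : A) • p' v
    simp
  rw [e]
  exact this

variable [CompleteSpace A]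

/-- The exponential has strict derivative the identity at 0, so its image contains a neighbourhood
of 1. -/
lemma exists_exp_eq_one_add :
    ∃ ε > 0, ∀ u : A, ‖u‖ < ε → ∃ a : A, NormedSpace.exp a = 1 + u := by
  have h := (hasStrictFDerivAt_exp_zero (𝕂 := ℂ) (𝔸 := A)).map_nhds_eq_of_surj
    (LinearMap.range_eq_top.2 fun y => ⟨y, rfl⟩)
  rw [NormedSpace.exp_zero] at h
  have h2 : Set.range (NormedSpace.exp : A → A) ∈ nhds (1 : A) := by
    rw [← h]
    exact Filter.mem_map.2 (Filter.univ_mem' fun a => ⟨a, rfl⟩)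
  obtain ⟨ε, hε, hsub⟩ := Metric.mem_nhds_iff.1 h2
  refine ⟨ε, hε, fun u hu => ?_⟩
  have : 1 + u ∈ Metric.ball (1 : A) ε := by simpa [Metric.mem_ball, dist_eq_norm] using hu
  exact hsub this

lemma exp_mul_exp_neg (a : A) : NormedSpace.exp a * NormedSpace.exp (-a) = 1 := by
  let _ : NormedAlgebra ℚ A := NormedAlgebra.restrictScalars ℚ ℂ A
  rw [← NormedSpace.exp_add_of_commute (Commute.refl a).neg_right, add_neg_cancel,
    NormedSpace.exp_zero]

/-- The data R and E are carried along as parameters: `Θ` maps (y, R, E) to the defect of the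
equation together with (R, E). Every nonlinear term is a product of factors vanishing at the origin,
so the derivative there sends (y, R, E) to (cy - (R - Pr R), R, E). This is surjective, so `Θ` maps
the ε-ball onto a neighbourhood of 0, which contains (0, R, E) for small data. -/
lemma exists_small_solution (Pr J : A →L[ℂ] A) {c : ℂ} (hc : c ≠ 0) {ε : ℝ} (hε : 0 < ε) :
    ∃ δ > 0, ∀ (R : A) (E : A →L[ℂ] A), ‖R‖ < δ → ‖E‖ < δ → ∃ y : A, ‖y‖ < ε ∧
      c • y + (E y - Pr (E y)) = (R + J y * R - Pr (R + J y * R) * J y) -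
        Pr (R + J y * R - Pr (R + J y * R) * J y) := by
  let X := A × A × (A →L[ℂ] A)
  let N : X → A := fun v => v.2.1 + J v.1 * v.2.1 - Pr (v.2.1 + J v.1 * v.2.1) * J v.1
  let Θ : X → X := fun v => (c • v.1 + (v.2.2 v.1 - Pr (v.2.2 v.1)) - (N v - Pr (N v)), v.2)
  have hy : HasStrictFDerivAt (fun v : X => v.1) (ContinuousLinearMap.fst ℂ A _) 0 :=
    hasStrictFDerivAt_fst
  have h2 : HasStrictFDerivAt (fun v : X => v.2) (ContinuousLinearMap.snd ℂ A _) 0 :=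
    hasStrictFDerivAt_snd
  have hR : HasStrictFDerivAt (fun v : X => v.2.1)
      ((ContinuousLinearMap.fst ℂ A _).comp (ContinuousLinearMap.snd ℂ A _)) 0 := h2.fst
  have hE : HasStrictFDerivAt (fun v : X => v.2.2)
      ((ContinuousLinearMap.snd ℂ A _).comp (ContinuousLinearMap.snd ℂ A _)) 0 := h2.snd
  have hJ : HasStrictFDerivAt (fun v : X => J v.1) (J.comp (ContinuousLinearMap.fst ℂ A _)) 0 :=
    J.hasStrictFDerivAt.comp 0 hy
  have hJR := hasStrictFDerivAt_mul_of_zero hJ hR (by simp) rfl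
  have hM := hR.add hJR
  have hS : HasStrictFDerivAt (fun v : X => Pr (v.2.1 + J v.1 * v.2.1)) _ 0 :=
    Pr.hasStrictFDerivAt.comp 0 hM
  have hSJ := hasStrictFDerivAt_mul_of_zero hS hJ (by simp) (by simp)
  have hN : HasStrictFDerivAt N _ 0 := hM.sub hSJ
  have hEy : HasStrictFDerivAt (fun v : X => v.2.2 v.1) (0 : X →L[ℂ] A) 0 := by
    have := hE.clm_apply hy
    simpa using this
  have hΘ : HasStrictFDerivAt Θ _ 0 :=
    ((((hy.const_smul c).add (hEy.sub (Pr.hasStrictFDerivAt.comp 0 hEy))).sub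
      (hN.sub (Pr.hasStrictFDerivAt.comp 0 hN))).prodMk h2)
  have hmap := hΘ.map_nhds_eq_of_surj (by
    refine LinearMap.range_eq_top.2 fun w => ⟨(c⁻¹ • (w.1 + (w.2.1 - Pr w.2.1)), w.2), ?_⟩
    refine Prod.ext ?_ rfl
    change c • (c⁻¹ • (w.1 + (w.2.1 - Pr w.2.1))) + ((0 : A) - Pr 0) -
      (w.2.1 + 0 - 0 - Pr (w.2.1 + 0 - 0)) = w.1
    simp [smul_smul, hc])
  have hΘ0 : Θ 0 = 0 := by simp [Θ, N]; rfl
  rw [hΘ0] at hmap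
  have himg : Θ '' Metric.ball 0 ε ∈ nhds (0 : X) := by
    rw [← hmap]
    exact Filter.image_mem_map (Metric.ball_mem_nhds 0 hε)
  obtain ⟨δ, hδ, hsub⟩ := Metric.mem_nhds_iff.1 himg
  refine ⟨δ, hδ, fun R E hRδ hEδ => ?_⟩
  have hmem : ((0, R, E) : X) ∈ Metric.ball (0 : X) δ := by
    rw [mem_ball_zero_iff, Prod.norm_def, Prod.norm_def]
    simp [hRδ, hEδ]
  obtain ⟨⟨y, R', E'⟩, hv, hv'⟩ := hsub hmem
  obtain ⟨h1, h3⟩ := Prod.ext_iff.1 hv'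
  obtain ⟨h4, h5⟩ := Prod.ext_iff.1 h3
  simp only [Θ] at h4 h5
  subst h4 h5
  refine ⟨y, ?_, sub_eq_zero.1 h1⟩
  rw [mem_ball_zero_iff, Prod.norm_def] at hv
  exact (le_max_left _ _).trans_lt hv

end BanachAlgebra
end AnalyticSymbols

/-! ### Dilations, the diagonal projection and the homological equation -/

namespace AnalyticSymbols

open Finset PowerSeries DoubleSeries WeylSeries
open scoped ENNReal

namespace WeylSeries

lemma osc_zero : osc 0 = X * C X := by
  refine DoubleSeries.ext_cf fun m n => ?_
  rw [osc, const_apply, if_pos rfl, cf_ofCf, cf, PowerSeries.coeff_mul_C, PowerSeries.coeff_X]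
  by_cases hm : m = 1 <;> simp [hm, PowerSeries.coeff_X]

lemma cf_osc_pow_zero (j m n : ℕ) :
    cf ((osc ^ j) 0) m n = if m = j ∧ n = j then 1 else 0 := by
  have h : ∀ j, (osc ^ j) 0 = X ^ j * C (X ^ j) := by
    intro j
    induction j with
    | zero => simp [one_apply]
    | succ j ih =>
      rw [pow_succ, mul_apply_zero, ih, osc_zero, map_pow, map_pow]
      ring
  rw [h, cf, PowerSeries.coeff_mul_C, PowerSeries.coeff_X_pow]
  by_cases hm : m = j <;> simp [hm, PowerSeries.coeff_X_pow]

lemma scale_osc (s : ℂ) : scale s osc = s ^ 2 • osc := by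
  refine ext_cf fun k m n => ?_
  rw [cf_scale, smul_apply, cf_smul, osc, const_apply]
  split_ifs with hk
  · rw [cf_ofCf]
    split_ifs with h
    · rw [h.1, h.2, hk]
    · simp
  · simp

lemma scale_hbar (s : ℂ) : scale s hbar = s ^ 2 • hbar := by
  refine ext_cf fun k m n => ?_
  rw [cf_scale, smul_apply, cf_smul, hbar_apply]
  split_ifs with hk
  · rw [cf_one]
    split_ifs with h
    · rw [h.1, h.2, hk]
    · simp
  · simp

end WeylSeries

namespace WeylAlgebra

/-- The rescaling `z ↦ s z`, `ζ ↦ s ζ`, `h ↦ s ^ 2 h` on `WeylAlgebra`, for `|s| ≤ 1`. -/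
def scaleL (s : ℂ) (hs : ‖s‖ ≤ 1) : WeylAlgebra →L[ℂ] WeylAlgebra :=
  multL (fun i => s ^ (2 * i.1 + i.2.1 + i.2.2)) fun _ => by
    rw [norm_pow]; exact pow_le_one₀ (norm_nonneg _) hs

lemma coe_scaleL (s : ℂ) (hs : ‖s‖ ≤ 1) (a : WeylAlgebra) : (scaleL s hs a).1 = scale s a.1 := by
  rw [scaleL, coe_multL, scale, AlgHom.ofLinearMap_apply]

lemma coefL_scaleL (s : ℂ) (hs : ‖s‖ ≤ 1) (a : WeylAlgebra) (k m n : ℕ) :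
    coefL k m n (scaleL s hs a) = s ^ (2 * k + m + n) * coefL k m n a := by
  rw [coefL_apply, coe_scaleL, cf_scale, coefL_apply]

lemma scaleL_mul (s : ℂ) (hs : ‖s‖ ≤ 1) (a b : WeylAlgebra) :
    scaleL s hs (a * b) = scaleL s hs a * scaleL s hs b := by
  apply WeylAlgebra.ext
  rw [coe_scaleL, coe_mul, coe_mul, coe_scaleL, coe_scaleL, map_mul]

lemma scaleL_osc_pow (s : ℂ) (hs : ‖s‖ ≤ 1) (j : ℕ) :
    scaleL s hs (oscA ^ j) = s ^ (2 * j) • oscA ^ j := by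
  apply WeylAlgebra.ext
  rw [coe_scaleL, coe_smul, coe_pow, oscA, map_pow, scale_osc, smul_pow,
    pow_mul]

lemma scaleL_hA (s : ℂ) (hs : ‖s‖ ≤ 1) : scaleL s hs hA = s ^ 2 • hA := by
  apply WeylAlgebra.ext
  rw [coe_scaleL, coe_smul, hA, scale_hbar]

lemma norm_oscA_le : ‖oscA‖ ≤ 4 := by
  rw [norm_le_iff _ (by norm_num)]
  change nrm osc ≤ _
  rw [nrm_of_monomial 0 1 1]
  · simp [osc, const_apply, wt, bk]
  · intro k m n h
    rw [osc, const_apply]; split_ifs with hk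
    · rw [cf_ofCf, if_neg (by tauto)]
    · simp

lemma norm_one_le : ‖(1 : WeylAlgebra)‖ ≤ 4 := by
  rw [norm_le_iff _ (by norm_num)]
  change nrm 1 ≤ _
  rw [nrm_of_monomial 0 0 0]
  · simp [one_apply, wt, bk, cf_one]
  · intro k m n h
    rw [one_apply]; split_ifs with hk
    · rw [cf_one, if_neg (by tauto)]
    · simp

lemma norm_oscA_pow_le (j : ℕ) : ‖oscA ^ j‖ ≤ 4 ^ (j + 1) := by
  induction j with
  | zero => simpa using norm_one_le
  | succ j ih =>
    rw [pow_succ, pow_succ]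
    exact (norm_mul_le _ _).trans (mul_le_mul ih norm_oscA_le (norm_nonneg _) (by positivity))

/-- The projection onto the terms `h ^ k z ^ m ζ ^ n` with `m = n`. -/
def diagL : WeylAlgebra →L[ℂ] WeylAlgebra :=
  multL (fun i => if i.2.1 = i.2.2 then 1 else 0) fun i => by split_ifs <;> simp

lemma coefL_diagL (a : WeylAlgebra) (k m n : ℕ) :
    coefL k m n (diagL a) = if m = n then coefL k m n a else 0 := by
  rw [coefL_apply, diagL, coe_multL, cf_mult, coefL_apply]
  split_ifs <;> simp

/-- A right inverse of `-i (z ∂_z - ζ ∂_ζ)` on terms with `m ≠ n`. -/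
def rotInvL : WeylAlgebra →L[ℂ] WeylAlgebra :=
  multL (fun i => if i.2.1 = i.2.2 then 0 else Complex.I / ((i.2.1 : ℂ) - i.2.2)) fun i => by
    split_ifs with h
    · simp
    · rw [norm_div, Complex.norm_I]
      refine div_le_one_of_le₀ ?_ (norm_nonneg _)
      -- The divisors are nonzero integers; this absence of small divisors makes the inverse a
      -- contraction.
      have h1 := Int.one_le_abs (show (i.2.1 : ℤ) - i.2.2 ≠ 0 by omega)
      rw [show (i.2.1 : ℂ) - i.2.2 = ((i.2.1 - i.2.2 : ℤ) : ℂ) by push_cast; rfl,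
        Complex.norm_intCast, ← Int.cast_abs]
      exact_mod_cast h1

lemma coefL_rotInvL (a : WeylAlgebra) (k m n : ℕ) : coefL k m n (rotInvL a) =
    if m = n then 0 else Complex.I / ((m : ℂ) - n) * coefL k m n a := by
  rw [coefL_apply, rotInvL, coe_multL, cf_mult, coefL_apply]
  split_ifs <;> simp

/-- The homological equation: off the diagonal the exact commutator formula for zζ can be inverted,
with h factoring out. -/
lemma oscA_mul_rotInvL {y : WeylAlgebra} (hy : diagL y = 0) :
    oscA * rotInvL y - rotInvL y * oscA = hA * y := by
  have hy' : (-Complex.I) • rot (rotInvL y).1 = y.1 := by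
    refine WeylSeries.ext_cf fun k m n => ?_
    rw [smul_apply, cf_smul, rot, cf_mult, ← coefL_apply, ← coefL_apply, coefL_rotInvL]
    split_ifs with h
    · have := coefL_diagL y k m n
      rw [hy, map_zero, if_pos h] at this
      rw [← this]; ring
    · have : (m : ℂ) - n ≠ 0 := sub_ne_zero.2 (by exact_mod_cast h)
      field_simp
      simp
  apply WeylAlgebra.ext
  have := osc_mul_sub_mul_osc (rotInvL y).1
  rw [hy'] at this
  exact this

lemma diagL_eq_self_iff (a : WeylAlgebra) : diagL a = a ↔ DegreeIn {0} a.1 := by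
  constructor
  · intro h k m n hne
    rw [← coefL_apply, ← h, coefL_diagL] at hne
    have : m = n := by by_contra h'; simp [h'] at hne
    simp [this]
  · refine fun h => ext_coefL fun k m n => ?_
    rw [coefL_diagL]
    split_ifs with hmn
    · rfl
    · by_contra hne
      have := h k m n (Ne.symm hne)
      rw [Set.mem_singleton_iff, sub_eq_zero] at this
      exact hmn (by exact_mod_cast this)

lemma diagL_eq_zero_iff (a : WeylAlgebra) : diagL a = 0 ↔ DegreeIn {0}ᶜ a.1 := by
  constructor
  · intro h k m n hne hmn
    rw [Set.mem_singleton_iff, sub_eq_zero] at hmn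
    have hmn' : m = n := by exact_mod_cast hmn
    have := coefL_diagL a k m n
    rw [h, map_zero, if_pos hmn'] at this
    exact hne this.symm
  · refine fun h => ext_coefL fun k m n => ?_
    rw [coefL_diagL, map_zero]
    split_ifs with hmn
    · by_contra hne
      have := h k m n hne
      simp [hmn] at this
    · rfl

lemma diagL_mul_of_diag_left {a b : WeylAlgebra} (ha : diagL a = a) (hb : diagL b = 0) :
    diagL (a * b) = 0 := by
  rw [diagL_eq_self_iff] at ha
  rw [diagL_eq_zero_iff] at hb ⊢
  refine DegreeIn.mul ha hb ?_
  rintro s rfl t ht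
  simpa using ht

lemma diagL_mul_of_diag_right {a b : WeylAlgebra} (ha : diagL a = 0) (hb : diagL b = b) :
    diagL (a * b) = 0 := by
  rw [diagL_eq_self_iff] at hb
  rw [diagL_eq_zero_iff] at ha ⊢
  refine DegreeIn.mul ha hb ?_
  rintro s hs t rfl
  simpa using hs

lemma diagL_mul {a b : WeylAlgebra} (ha : diagL a = a) (hb : diagL b = b) :
    diagL (a * b) = a * b := by
  rw [diagL_eq_self_iff] at ha hb ⊢
  refine DegreeIn.mul ha hb ?_
  rintro s rfl t rfl
  simp

lemma diagL_diagL (a : WeylAlgebra) : diagL (diagL a) = diagL a :=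
  ext_coefL fun k m n => by rw [coefL_diagL, coefL_diagL]; split_ifs <;> rfl

lemma diagL_rotInvL (a : WeylAlgebra) : diagL (rotInvL a) = 0 :=
  ext_coefL fun k m n => by rw [coefL_diagL, coefL_rotInvL, map_zero]; split_ifs <;> rfl

lemma diagL_oscA : diagL oscA = oscA := (diagL_eq_self_iff _).2 degreeIn_osc

lemma diagL_hA : diagL hA = hA := (diagL_eq_self_iff _).2 degreeIn_hbar

lemma diagL_one : diagL 1 = 1 := by
  rw [diagL_eq_self_iff]
  intro k m n
  change cf ((1 : WeylSeries) k) m n ≠ 0 → _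
  rw [one_apply]
  split_ifs
  · rw [cf_one]; split_ifs with h <;> simp [h]
  · simp

lemma diagL_oscA_pow (j : ℕ) : diagL (oscA ^ j) = oscA ^ j := by
  induction j with
  | zero => simpa using diagL_one
  | succ j ih => rw [pow_succ]; exact diagL_mul ih diagL_oscA

/-- The map `y ↦ ∑_{i < j} (zζ) ^ i y (zζ) ^ (j - 1 - i)`. -/
def oscSum : ℕ → WeylAlgebra →L[ℂ] WeylAlgebra
  | 0 => 0
  | j + 1 => (ContinuousLinearMap.mul ℂ WeylAlgebra oscA).comp (oscSum j) +
      (ContinuousLinearMap.mul ℂ WeylAlgebra).flip (oscA ^ j)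

lemma oscSum_succ_apply (j : ℕ) (y : WeylAlgebra) :
    oscSum (j + 1) y = oscA * oscSum j y + y * oscA ^ j := rfl

lemma oscSum_one_apply (y : WeylAlgebra) : oscSum 1 y = y := by
  rw [oscSum_succ_apply]; simp [oscSum]

lemma norm_oscSum_le (j : ℕ) : ‖oscSum j‖ ≤ j * 4 ^ j := by
  induction j with
  | zero => simp [oscSum]
  | succ j ih =>
    refine ContinuousLinearMap.opNorm_le_bound _ (by positivity) fun y => ?_
    rw [oscSum_succ_apply]
    have h1 : ‖oscA * oscSum j y‖ ≤ 4 * (j * 4 ^ j * ‖y‖) :=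
      (norm_mul_le _ _).trans (mul_le_mul norm_oscA_le ((oscSum j).le_of_opNorm_le ih y)
        (norm_nonneg _) (by norm_num))
    have h2 : ‖y * oscA ^ j‖ ≤ ‖y‖ * 4 ^ (j + 1) :=
      (norm_mul_le _ _).trans (mul_le_mul_of_nonneg_left (norm_oscA_pow_le j) (norm_nonneg _))
    refine (norm_add_le _ _).trans ((add_le_add h1 h2).trans_eq ?_)
    push_cast; ring

/-- The commutator with u is a derivation, expanded here over a power. It expresses [(zζ)^j, u]
through [zζ, u] without any loss in the norm from derivatives. -/
lemma oscA_pow_comm (j : ℕ) (u : WeylAlgebra) :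
    oscA ^ j * u - u * oscA ^ j = oscSum j (oscA * u - u * oscA) := by
  induction j with
  | zero => simp [oscSum]
  | succ j ih =>
    rw [oscSum_succ_apply, ← ih, pow_succ']
    noncomm_ring

lemma oscSum_hA_mul (j : ℕ) (y : WeylAlgebra) : oscSum j (hA * y) = hA * oscSum j y := by
  induction j with
  | zero => simp [oscSum]
  | succ j ih =>
    rw [oscSum_succ_apply, oscSum_succ_apply, ih, mul_add, ← mul_assoc, ← hA_comm oscA]
    simp only [mul_assoc]

lemma diagL_oscSum (j : ℕ) {y : WeylAlgebra} (hy : diagL y = 0) : diagL (oscSum j y) = 0 := by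
  induction j with
  | zero => simp [oscSum]
  | succ j ih =>
    rw [oscSum_succ_apply, map_add, diagL_mul_of_diag_left diagL_oscA ih,
      diagL_mul_of_diag_right hy (diagL_oscA_pow j), add_zero]

end WeylAlgebra
end AnalyticSymbols

/-! ### The conjugation in the Banach algebra -/

namespace AnalyticSymbols

open Finset PowerSeries DoubleSeries WeylSeries

lemma hasSum_of_forall_eq {M : Type*} [AddCommMonoid M] [TopologicalSpace M] {f f' : ℕ → M}
    {x : M} (h : HasSum f x) (e : ∀ j, f' j = f j) : HasSum f' x :=
  (funext e : f' = f) ▸ h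

namespace WeylAlgebra

lemma coefL_zero_oscA_pow (j m n : ℕ) :
    coefL 0 m n (oscA ^ j) = if m = j ∧ n = j then 1 else 0 := by
  rw [coefL_apply, coe_pow]
  exact cf_osc_pow_zero j m n

lemma coefL_zero_hA_mul (m n : ℕ) (a : WeylAlgebra) : coefL 0 m n (hA * a) = 0 := by
  rw [coefL_apply]
  change cf ((hbar * a.1) 0) m n = 0
  rw [hbar_mul_zero, cf_zero]

lemma norm_coefL_zero_diag_le (a : WeylAlgebra) (m : ℕ) : ‖coefL 0 m m a‖ ≤ ‖a‖ := by
  refine (norm_cf_le a 0 m m).trans (mul_le_of_le_one_left (norm_nonneg _) ?_)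
  have : bk 0 m m = 1 := by
    rw [bk, zero_add, Nat.factorial_zero]
    have : (m.factorial : ℝ) ≠ 0 := by positivity
    field_simp
    simp
  rw [this]; norm_num

/-- Every monomial other than the constant has weight 2k + m + n at least 1, so it gains at least
one factor s. -/
lemma norm_scaleL_le {s : ℝ} (h0 : 0 ≤ s) (hs : ‖(s : ℂ)‖ ≤ 1) {a : WeylAlgebra}
    (ha : coefL 0 0 0 a = 0) : ‖scaleL s hs a‖ ≤ s * ‖a‖ := by
  have hs1 : s ≤ 1 := by simpa [abs_of_nonneg h0] using hs
  have : ‖scaleL s hs a‖ ≤ ‖(s : ℂ) • a‖ := by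
    rw [norm_le_iff _ (norm_nonneg _), ofReal_norm_eq]
    refine nrm_mono fun k m n => ?_
    rw [← coefL_apply, ← coefL_apply, coefL_scaleL, map_smul, smul_eq_mul, norm_mul, norm_mul]
    by_cases h : 2 * k + m + n = 0
    · obtain ⟨rfl, rfl, rfl⟩ : k = 0 ∧ m = 0 ∧ n = 0 := by omega
      simp [ha]
    · refine mul_le_mul_of_nonneg_right ?_ (norm_nonneg _)
      rw [norm_pow]
      exact pow_le_of_le_one (norm_nonneg _) hs h
  refine this.trans ?_
  rw [norm_smul, Complex.norm_real, Real.norm_of_nonneg h0]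

/-- Division by `h` after rescaling. -/
lemma exists_divH {a : WeylAlgebra} (ha : ∀ m n, coefL 0 m n a = 0)
    (hs : ‖((1 / 2 : ℝ) : ℂ)‖ ≤ 1) :
    ∃ y : WeylAlgebra, scaleL (1 / 2 : ℝ) hs a = hA * y ∧
      coefL 0 0 0 y = 4⁻¹ * coefL 1 0 0 a := by
  have hmem : scale ((1 / 2 : ℝ) : ℂ) (divH a.1) ∈ weylSubalgebra := by
    have := (nrm_divH_le a.1).trans_lt a.2
    rwa [show (1 / 2 : ℂ) = ((1 / 2 : ℝ) : ℂ) by push_cast; rfl] at this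
  have h0 : a.1 0 = 0 := DoubleSeries.ext_cf fun m n => (ha m n).trans (cf_zero m n).symm
  -- The dilation by 1/2 turns h into h/4.
  refine ⟨(4⁻¹ : ℂ) • ⟨_, hmem⟩, ?_, ?_⟩
  · rw [mul_smul_comm]
    apply WeylAlgebra.ext
    rw [coe_scaleL, coe_smul, coe_mul]
    conv_lhs => rw [← hbar_mul_divH h0, map_mul, scale_hbar, smul_mul_assoc]
    congr 1
    push_cast; norm_num
  · rw [map_smul, smul_eq_mul, coefL_apply, cf_scale, divH_apply]
    simp [coefL_apply]

-- Three successive dilations are used: by 1/4 so that the series F converges, by 1/2 so that the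
-- remainder can be divided by h, and by τ so that R and E become small; hence s = τ/8.
set_option maxHeartbeats 1000000 in
theorem exists_conjugation (Q : WeylAlgebra) (γ : ℕ → ℂ) (hγ : γ 1 ≠ 0)
    (hQ : ∀ m n, coefL 0 m n Q = if m = n then γ m else 0) :
    ∃ (s : ℝ) (hs : ‖(s : ℂ)‖ ≤ 1) (a B : WeylAlgebra), 0 < s ∧
      (∀ k m n, m ≠ n → coefL k m n B = 0) ∧
      (∀ m n, coefL 0 m n B = coefL 0 m n (scaleL s hs Q)) ∧
      NormedSpace.exp a * scaleL s hs Q * NormedSpace.exp (-a) = B := by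
  have h4 : ‖((1 / 4 : ℝ) : ℂ)‖ ≤ 1 := by rw [Complex.norm_real]; norm_num
  have h2 : ‖((1 / 2 : ℝ) : ℂ)‖ ≤ 1 := by rw [Complex.norm_real]; norm_num
  -- The dilation multiplies the coefficient of (zζ)^j by 16^(-j), which beats the bound 4^(j+1) for
  -- the norm of the Weyl power (zζ)^j.
  set Q₁ := scaleL (1 / 4 : ℝ) h4 Q with hQ₁
  set c : ℕ → ℂ := fun j => (1 / 16 : ℂ) ^ j * γ j with hc
  have hcj : ∀ j, c j = (1 / 16 : ℂ) ^ j * γ j := fun _ => rfl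
  have hQ₁c : ∀ m n, coefL 0 m n Q₁ = if m = n then c m else 0 := fun m n => by
    rw [hQ₁, coefL_scaleL, hQ]
    split_ifs with h
    · rw [← h, hcj, mul_zero, zero_add, ← two_mul, pow_mul]
      norm_num
    · simp
  have hc1 : c 1 ≠ 0 := by rw [hcj]; simpa using hγ
  have hcb : ∀ j, ‖c j‖ ≤ ‖Q‖ * (1 / 16) ^ j := fun j => by
    have := norm_coefL_zero_diag_le Q j
    rw [hQ, if_pos rfl] at this
    rw [hcj, norm_mul, mul_comm, norm_pow]
    norm_num
    gcongr
  have hsumF : Summable fun j => c j • oscA ^ j := by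
    refine Summable.of_norm_bounded (g := fun j => ‖Q‖ * 4 * (1 / 4) ^ j)
      ((summable_geometric_of_lt_one (by norm_num) (by norm_num)).mul_left _) fun j => ?_
    rw [norm_smul]
    refine (mul_le_mul (hcb j) (norm_oscA_pow_le j) (norm_nonneg _) (by positivity)).trans_eq ?_
    rw [pow_succ, show (1 / 4 : ℝ) = 1 / 16 * 4 by norm_num, mul_pow]
    ring
  -- Weyl powers are used so that commutators with F are computable exactly. Their order 0 parts are
  -- ordinary powers of zζ, so Q₁ - F is divisible by h.
  set F := ∑' j, c j • oscA ^ j with hF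
  have hFsum : HasSum (fun j => c j • oscA ^ j) F := hsumF.hasSum
  have hF0 : ∀ m n, coefL 0 m n F = if m = n then c m else 0 := fun m n => by
    have h := hFsum.mapL (coefL 0 m n)
    simp only [map_smul, coefL_zero_oscA_pow, smul_eq_mul] at h
    refine h.unique ?_
    split_ifs with hmn
    · subst hmn
      convert hasSum_single m _ using 1
      · simp
      · intro j hj; simp [hj.symm]
    · convert hasSum_zero using 2 with j
      rw [if_neg (by rintro ⟨rfl, rfl⟩; exact hmn rfl), mul_zero]
  -- Since h is central, κh does not affect the commutator. Subtracting it leaves a quotient by h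
  -- with no constant term, which dilation therefore makes small.
  set κ := coefL 1 0 0 (Q₁ - F) with hκ
  have hX0 : ∀ m n, coefL 0 m n (Q₁ - F - κ • hA) = 0 := fun m n => by
    have := coefL_zero_hA_mul m n 1
    rw [mul_one] at this
    rw [map_sub, map_sub, map_smul, hQ₁c, hF0, this]
    simp
  have hX1 : coefL 1 0 0 (Q₁ - F - κ • hA) = 0 := by
    have : coefL 1 0 0 hA = 1 := by
      rw [coefL_apply]
      change cf (hbar 1) 0 0 = 1
      simp [hbar_apply, cf_one]
    rw [map_sub, map_smul, this, ← hκ]; simp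
  obtain ⟨Y, hY, hY0⟩ := exists_divH hX0 h2
  rw [hX1, mul_zero] at hY0
  -- the error operators
  have hE : ∀ t : ℝ, 0 ≤ t → t ≤ 1 → ∃ E : WeylAlgebra →L[ℂ] WeylAlgebra,
      ‖E‖ ≤ t * (‖Q‖ * ∑' j : ℕ, (j + 2 : ℕ) * (1 / 4 : ℝ) ^ (j + 2)) ∧
      HasSum (fun j => (c (j + 2) * (t : ℂ) ^ (2 * j + 2)) • oscSum (j + 2)) E := by
    intro t ht0 ht1
    have hsum : Summable fun j : ℕ => (j : ℝ) * (1 / 4 : ℝ) ^ j := by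
      simpa using summable_pow_mul_geometric_of_norm_lt_one 1 (r := (1 / 4 : ℝ)) (by norm_num)
    have hsum2 : Summable fun j : ℕ => ((j + 2 : ℕ) : ℝ) * (1 / 4 : ℝ) ^ (j + 2) :=
      (summable_nat_add_iff 2).2 hsum
    have hb : ∀ j : ℕ, ‖(c (j + 2) * (t : ℂ) ^ (2 * j + 2)) • oscSum (j + 2)‖ ≤
        t * ‖Q‖ * (((j + 2 : ℕ) : ℝ) * (1 / 4 : ℝ) ^ (j + 2)) := fun j => by
      rw [norm_smul, norm_mul, norm_pow, Complex.norm_real, Real.norm_of_nonneg ht0]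
      have h1 : t ^ (2 * j + 2) ≤ t := pow_le_of_le_one ht0 ht1 (by omega)
      refine (mul_le_mul (mul_le_mul (hcb _) h1 (by positivity) (by positivity))
        (norm_oscSum_le _) (norm_nonneg _) (by positivity)).trans_eq ?_
      rw [show (1 / 4 : ℝ) = 1 / 16 * 4 by norm_num, mul_pow]
      ring
    have hs := Summable.of_norm_bounded (hsum2.mul_left (t * ‖Q‖)) hb
    refine ⟨_, ?_, hs.hasSum⟩
    refine (tsum_of_norm_bounded (hsum2.mul_left (t * ‖Q‖)).hasSum hb).trans_eq ?_
    rw [tsum_mul_left, mul_assoc]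
  set K := ‖Q‖ * ∑' j : ℕ, (j + 2 : ℕ) * (1 / 4 : ℝ) ^ (j + 2) with hK
  obtain ⟨ε, hε, hexp⟩ := exists_exp_eq_one_add (A := WeylAlgebra)
  obtain ⟨ε', hε', hJ⟩ : ∃ ε' > 0, ∀ y, ‖y‖ < ε' → ‖rotInvL y‖ < ε := by
    have := (rotInvL.continuous.tendsto 0).norm
    rw [map_zero, norm_zero] at this
    obtain ⟨ε', h1, h3⟩ := Metric.eventually_nhds_iff.1 (this.eventually_lt_const hε)
    exact ⟨ε', h1, fun y hy => h3 (by rwa [dist_zero_right])⟩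
  obtain ⟨δ, hδ, hsolve⟩ := exists_small_solution diagL rotInvL hc1 hε'
  obtain ⟨τ, hτ0, hτ1, hτK, hτY⟩ : ∃ τ : ℝ, 0 < τ ∧ τ ≤ 1 ∧ τ * K < δ ∧ τ * (4 * ‖Y‖) < δ := by
    have t1 : Filter.Tendsto (fun τ : ℝ => τ * K) (nhdsWithin 0 (Set.Ioi 0)) (nhds 0) := by
      simpa using (Filter.tendsto_id.mul_const K : Filter.Tendsto (fun τ : ℝ => τ * K)
        (nhds 0) (nhds (0 * K))).mono_left nhdsWithin_le_nhds
    have t2 : Filter.Tendsto (fun τ : ℝ => τ * (4 * ‖Y‖)) (nhdsWithin 0 (Set.Ioi 0)) (nhds 0) := by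
      simpa using (Filter.tendsto_id.mul_const (4 * ‖Y‖) : Filter.Tendsto (fun τ : ℝ => τ * (4 * ‖Y‖))
        (nhds 0) (nhds (0 * (4 * ‖Y‖)))).mono_left nhdsWithin_le_nhds
    have t3 : ∀ᶠ τ : ℝ in nhdsWithin 0 (Set.Ioi 0), τ ∈ Set.Ioc (0 : ℝ) 1 :=
      Ioc_mem_nhdsGT zero_lt_one
    obtain ⟨τ, h1, h3, h5⟩ := ((t1.eventually_lt_const hδ).and
      ((t2.eventually_lt_const hδ).and t3)).exists
    exact ⟨τ, h5.1, h5.2, h1, h3⟩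
  have hτ : ‖(τ : ℂ)‖ ≤ 1 := by
    rw [Complex.norm_real, Real.norm_of_nonneg hτ0.le]; exact hτ1
  obtain ⟨E, hEn, hEs⟩ := hE (τ / 2) (by positivity) (by linarith)
  have hK0 : 0 ≤ K := by positivity
  have hEδ : ‖E‖ < δ := hEn.trans_lt (lt_of_le_of_lt (by gcongr; linarith) hτK)
  -- The dilation by τ turns h into τ²h, and τ² = 4t² with t = τ/2 as below; the factor 4 leaves the
  -- same t² in front of hR as in front of the leading part of [F, u].
  set R : WeylAlgebra := (4 : ℂ) • scaleL τ hτ Y with hR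
  have hRδ : ‖R‖ < δ := by
    rw [hR, norm_smul, Complex.norm_ofNat]
    have := norm_scaleL_le hτ0.le hτ hY0
    exact lt_of_le_of_lt (by linarith) hτY
  obtain ⟨y, hyε, hy⟩ := hsolve R E hRδ hEδ
  set t : ℂ := ((τ / 2 : ℝ) : ℂ) with ht
  have htτ : (τ : ℂ) = 2 * t := by rw [ht]; push_cast; ring
  set u := rotInvL y with hu
  set S := diagL (R + u * R) with hS
  set Ft := scaleL τ hτ (scaleL (1 / 2 : ℝ) h2 F) with hFt
  have hFts : HasSum (fun j => (c j * t ^ (2 * j)) • oscA ^ j) Ft := by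
    have h := (hFsum.mapL (scaleL (1 / 2 : ℝ) h2)).mapL (scaleL τ hτ)
    convert h using 2 with j
    rw [map_smul, map_smul, scaleL_osc_pow, map_smul, scaleL_osc_pow, smul_smul, smul_smul, htτ,
      mul_assoc (c j), ← mul_pow]
    push_cast
    congr 3
    ring
  have hs : ‖((τ / 8 : ℝ) : ℂ)‖ ≤ 1 := by
    rw [Complex.norm_real, Real.norm_of_nonneg (by positivity)]; linarith
  have hQt : scaleL (τ / 8 : ℝ) hs Q = Ft + (κ * t ^ 2) • hA + t ^ 2 • (hA * R) := by
    have e1 : scaleL (τ / 8 : ℝ) hs Q = scaleL τ hτ (scaleL (1 / 2 : ℝ) h2 Q₁) :=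
      ext_coefL fun k m n => by
        simp only [hQ₁, coefL_scaleL]
        rw [← mul_assoc, ← mul_assoc, ← mul_pow, ← mul_pow]
        congr 2
        push_cast; ring
    have e2 : Q₁ = F + κ • hA + (Q₁ - F - κ • hA) := by abel
    rw [e1, e2, map_add, map_add, map_add, map_add, hY, scaleL_mul, map_smul, scaleL_hA, map_smul,
      map_smul, scaleL_hA, ← hFt, hR, smul_smul, smul_smul, mul_smul_comm, smul_smul,
      smul_mul_assoc]
    have e3 : κ * ((1 / 2 : ℝ) : ℂ) ^ 2 * (τ : ℂ) ^ 2 = κ * t ^ 2 := by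
      rw [ht]; push_cast; ring
    have e4 : (τ : ℂ) ^ 2 = t ^ 2 * 4 := by rw [htτ]; ring
    rw [e3, e4]
  -- `y` has no diagonal part
  have hyd : diagL y = 0 := by
    have h := congrArg diagL hy
    simp only [map_add, map_sub, map_smul, diagL_diagL, sub_self, add_zero] at h
    exact (smul_eq_zero.1 h).resolve_left hc1
  have hEd : diagL (E y) = 0 := by
    have h := ((hEs.mapL (ContinuousLinearMap.apply ℂ WeylAlgebra y)).mapL diagL)
    refine h.unique ?_
    convert hasSum_zero using 2 with j
    simp [diagL_oscSum (j + 2) hyd]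
  have hSd : diagL S = S := diagL_diagL _
  have hSu : diagL (S * u) = 0 := diagL_mul_of_diag_left hSd (diagL_rotInvL y)
  have hmain : c 1 • y + E y = R + u * R - S * u - S := by
    rw [map_sub, hSu, hEd, sub_zero, sub_zero, ← hS] at hy
    exact hy
  -- the commutator of the principal part with `u`
  have hcomm : Ft * u - u * Ft = t ^ 2 • (hA * (c 1 • y + E y)) := by
    have h := (hFts.mul_right u).sub (hFts.mul_left u)
    have h' : HasSum (fun j => (c j * t ^ (2 * j)) • (hA * oscSum j y)) (Ft * u - u * Ft) := by
      refine hasSum_of_forall_eq h fun j => ?_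
      rw [smul_mul_assoc, mul_smul_comm, ← smul_sub, oscA_pow_comm, oscA_mul_rotInvL hyd,
        oscSum_hA_mul]
    have hE2 : HasSum (fun j => (c (j + 2) * t ^ (2 * (j + 2))) • (hA * oscSum (j + 2) y))
        (t ^ 2 • (hA * E y)) := by
      have h := ((hEs.mapL (ContinuousLinearMap.apply ℂ WeylAlgebra y)).mul_left hA).const_smul
        (t ^ 2)
      refine hasSum_of_forall_eq h fun j => ?_
      change _ = t ^ 2 • (hA * ((c (j + 2) * ((τ / 2 : ℝ) : ℂ) ^ (2 * j + 2)) • oscSum (j + 2) y))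
      rw [mul_smul_comm, smul_smul, ← ht]
      congr 1
      ring
    -- The term j = 0 vanishes, j = 1 gives c_1 y, and the terms j ≥ 2 form E y.
    have h3 := (hasSum_nat_add_iff' 2).2 h'
    have h4 := h3.unique hE2
    rw [sub_eq_iff_eq_add] at h4
    rw [h4, Finset.sum_range_succ, Finset.sum_range_one, oscSum_one_apply, mul_add, smul_add,
      mul_smul_comm, smul_smul, mul_comm (t ^ 2) (c 1)]
    simp [oscSum, add_comm]
  obtain ⟨a, ha⟩ := hexp u (hJ y hyε)
  set B := Ft + (κ * t ^ 2) • hA + t ^ 2 • (hA * S) with hB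
  -- Once the central term κh cancels, this is the commutator identity combined with `hmain`.
  have hUQ : (1 + u) * scaleL (τ / 8 : ℝ) hs Q = B * (1 + u) := by
    have e1 := hcomm
    rw [hmain] at e1
    have e2 : u * hA = hA * u := (hA_comm u).symm
    have e3 : u * (hA * R) = hA * (u * R) := by rw [← mul_assoc, e2, mul_assoc]
    rw [hQt, hB]
    simp only [mul_add, add_mul, mul_sub, smul_add, smul_sub, one_mul, mul_one, mul_smul_comm,
      smul_mul_assoc, e2, e3, mul_assoc] at e1 ⊢
    rw [sub_eq_iff_eq_add] at e1
    rw [e1]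
    abel
  have hFd : diagL Ft = Ft := by
    refine (hFts.mapL diagL).unique ?_
    convert hFts using 2 with j
    rw [map_smul, diagL_oscA_pow]
  have hBd : diagL B = B := by
    rw [hB, map_add, map_add, map_smul, map_smul, hFd, diagL_hA, diagL_mul diagL_hA hSd]
  refine ⟨τ / 8, hs, a, B, by positivity, ?_, ?_, ?_⟩
  · intro k m n hmn
    rw [← hBd, coefL_diagL, if_neg hmn]
  · intro m n
    rw [hQt, hB]
    simp only [map_add, map_smul, coefL_zero_hA_mul]
  · rw [ha, hUQ, ← ha, mul_assoc, exp_mul_exp_neg, mul_one]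

end WeylAlgebra
end AnalyticSymbols

/-! ### Convergent double power series and their sums -/

namespace AnalyticSymbols

open Finset PowerSeries DoubleSeries

namespace DoubleSeries

/-- Absolute convergence on the open polydisc of radius `ρ`. -/
def Converges (ρ : ℝ) (f : DoubleSeries) : Prop :=
  ∀ r : ℝ, 0 ≤ r → r < ρ → Summable fun i : ℕ × ℕ => ‖cf f i.1 i.2‖ * r ^ (i.1 + i.2)

/-- The sum of a double power series. -/
def ev (f : DoubleSeries) (p : ℂ × ℂ) : ℂ := ∑' i : ℕ × ℕ, cf f i.1 i.2 * p.1 ^ i.1 * p.2 ^ i.2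

variable {ρ : ℝ} {f g : DoubleSeries} {p : ℂ × ℂ}

lemma norm_term_le {r : ℝ} (hp : ‖p‖ ≤ r) (i : ℕ × ℕ) :
    ‖cf f i.1 i.2 * p.1 ^ i.1 * p.2 ^ i.2‖ ≤ ‖cf f i.1 i.2‖ * r ^ (i.1 + i.2) := by
  rw [norm_mul, norm_mul, norm_pow, norm_pow, mul_assoc, pow_add]
  have h1 := (norm_fst_le p).trans hp
  have h2 := (norm_snd_le p).trans hp
  have h3 := (norm_nonneg p).trans hp
  gcongr

lemma Converges.summable_norm (hf : Converges ρ f) (hp : ‖p‖ < ρ) :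
    Summable fun i : ℕ × ℕ => ‖cf f i.1 i.2 * p.1 ^ i.1 * p.2 ^ i.2‖ :=
  .of_nonneg_of_le (fun _ => norm_nonneg _) (norm_term_le le_rfl) (hf _ (norm_nonneg _) hp)

lemma Converges.hasSum (hf : Converges ρ f) (hp : ‖p‖ < ρ) :
    HasSum (fun i : ℕ × ℕ => cf f i.1 i.2 * p.1 ^ i.1 * p.2 ^ i.2) (ev f p) :=
  (hf.summable_norm hp).of_norm.hasSum

lemma Converges.add (hf : Converges ρ f) (hg : Converges ρ g) : Converges ρ (f + g) :=
  fun r h0 h1 => .of_nonneg_of_le (fun _ => by positivity)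
    (fun i => by
      rw [cf_add, ← add_mul]
      exact mul_le_mul_of_nonneg_right (norm_add_le _ _) (by positivity))
    ((hf r h0 h1).add (hg r h0 h1))

lemma Converges.smul (hf : Converges ρ f) (c : ℂ) : Converges ρ (c • f) := fun r h0 h1 => by
  simpa only [cf_smul, norm_mul, mul_assoc] using (hf r h0 h1).mul_left ‖c‖

lemma converges_zero : Converges ρ 0 := fun r _ _ => by simp

lemma Converges.sum {ι : Type*} {s : Finset ι} {F : ι → DoubleSeries}
    (h : ∀ i ∈ s, Converges ρ (F i)) : Converges ρ (∑ i ∈ s, F i) :=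
  Finset.sum_induction F (Converges ρ) (fun _ _ => Converges.add) converges_zero h

lemma ev_add (hf : Converges ρ f) (hg : Converges ρ g) (hp : ‖p‖ < ρ) :
    ev (f + g) p = ev f p + ev g p :=
  HasSum.tsum_eq (by simpa only [cf_add, add_mul] using (hf.hasSum hp).add (hg.hasSum hp))

lemma ev_smul (c : ℂ) : ev (c • f) p = c * ev f p := by
  simp only [ev, cf_smul, mul_assoc, tsum_mul_left]

lemma ev_sum {ι : Type*} {s : Finset ι} {F : ι → DoubleSeries}
    (h : ∀ i ∈ s, Converges ρ (F i)) (hp : ‖p‖ < ρ) :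
    ev (∑ i ∈ s, F i) p = ∑ i ∈ s, ev (F i) p := by
  classical
  induction s using Finset.induction_on with
  | empty => simp [ev]
  | insert i s hi ih =>
    rw [Finset.sum_insert hi, Finset.sum_insert hi, ev_add (ρ := ρ) _ (Converges.sum _) hp, ih]
    · exact fun j hj => h j (Finset.mem_insert_of_mem hj)
    · exact h i (Finset.mem_insert_self _ _)
    · exact fun j hj => h j (Finset.mem_insert_of_mem hj)

/-- Antidiagonals in `ℕ × ℕ` are products of antidiagonals. -/
abbrev antidiagonalNatProd : HasAntidiagonal (ℕ × ℕ) where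
  antidiagonal i := (antidiagonal i.1 ×ˢ antidiagonal i.2).map
    (Equiv.prodProdProdComm ℕ ℕ ℕ ℕ).toEmbedding
  mem_antidiagonal := by
    rintro ⟨m, n⟩ ⟨⟨a, b⟩, ⟨c, d⟩⟩
    simp [Finset.mem_map_equiv]

attribute [local instance] antidiagonalNatProd

lemma sum_antidiagonalNatProd {M : Type*} [AddCommMonoid M] (i : ℕ × ℕ)
    (F : (ℕ × ℕ) × (ℕ × ℕ) → M) : ∑ x ∈ antidiagonal i, F x =
      ∑ s ∈ antidiagonal i.1, ∑ t ∈ antidiagonal i.2, F ((s.1, t.1), (s.2, t.2)) := by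
  change ∑ x ∈ (antidiagonal i.1 ×ˢ antidiagonal i.2).map
    (Equiv.prodProdProdComm ℕ ℕ ℕ ℕ).toEmbedding, F x = _
  rw [Finset.sum_map, Finset.sum_product]
  rfl

lemma cf_mul_pow (r s : ℂ) (i : ℕ × ℕ) : cf (f * g) i.1 i.2 * r ^ i.1 * s ^ i.2 =
    ∑ x ∈ antidiagonal i, (cf f x.1.1 x.1.2 * r ^ x.1.1 * s ^ x.1.2) *
      (cf g x.2.1 x.2.2 * r ^ x.2.1 * s ^ x.2.2) := by
  rw [sum_antidiagonalNatProd, cf_mul, Finset.sum_mul, Finset.sum_mul]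
  refine Finset.sum_congr rfl fun a ha => ?_
  rw [Finset.sum_mul, Finset.sum_mul]
  refine Finset.sum_congr rfl fun b hb => ?_
  rw [← HasAntidiagonal.mem_antidiagonal.1 ha, ← HasAntidiagonal.mem_antidiagonal.1 hb]
  ring

lemma Converges.mul (hf : Converges ρ f) (hg : Converges ρ g) : Converges ρ (f * g) := by
  intro r h0 h1
  have hr : ‖((r : ℂ), (r : ℂ))‖ < ρ := by simpa [Prod.norm_def, abs_of_nonneg h0] using h1
  have h := summable_sum_mul_antidiagonal_of_summable_mul
    (summable_mul_of_summable_norm (hf.summable_norm hr).norm (hg.summable_norm hr).norm)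
  refine .of_nonneg_of_le (fun _ => by positivity) (fun i => ?_) h
  have e := cf_mul_pow (f := f) (g := g) (r : ℂ) (r : ℂ) i
  have : ‖cf (f * g) i.1 i.2‖ * r ^ (i.1 + i.2) = ‖cf (f * g) i.1 i.2 * (r : ℂ) ^ i.1 * (r : ℂ) ^ i.2‖ := by
    rw [norm_mul, norm_mul, norm_pow, norm_pow, Complex.norm_real, Real.norm_of_nonneg h0, mul_assoc,
      pow_add]
  rw [this, e]
  refine (norm_sum_le _ _).trans_eq (Finset.sum_congr rfl fun x _ => ?_)
  rw [norm_mul]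

lemma ev_mul (hf : Converges ρ f) (hg : Converges ρ g) (hp : ‖p‖ < ρ) :
    ev (f * g) p = ev f p * ev g p := by
  have hf' := hf.summable_norm hp
  have hg' := hg.summable_norm hp
  have hs := summable_mul_of_summable_norm hf' hg'
  have h := hf'.of_norm.tsum_mul_tsum_eq_tsum_sum_antidiagonal hg'.of_norm hs
  simp only [← cf_mul_pow] at h
  exact h.symm

/-- The left side is one term of the binomial expansion of the right. It shows that a termwise
derivative still converges at any smaller radius. -/
lemma succ_mul_pow_mul_le {r δ : ℝ} (hr : 0 ≤ r) (hδ : 0 ≤ δ) (m : ℕ) :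
    (m + 1) * r ^ m * δ ≤ (r + δ) ^ (m + 1) := by
  induction m with
  | zero => simp [hr]
  | succ m ih =>
    have h1 : r ^ (m + 1) ≤ (r + δ) ^ (m + 1) := by gcongr; linarith
    calc ((m + 1 : ℕ) + 1) * r ^ (m + 1) * δ = r * ((m + 1) * r ^ m * δ) + δ * r ^ (m + 1) := by
          push_cast; ring
      _ ≤ r * (r + δ) ^ (m + 1) + δ * (r + δ) ^ (m + 1) := by gcongr
      _ = _ := by ring

lemma Converges.dz (hf : Converges ρ f) : Converges ρ (dz f) := by
  intro r h0 h1
  obtain ⟨r', h2, h3⟩ := exists_between h1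
  have hδ : 0 < r' - r := by linarith
  have h := ((hf r' (h0.trans h2.le) h3).comp_injective
    (i := fun i : ℕ × ℕ => (i.1 + 1, i.2)) fun i j hij => by
      simp only [Prod.mk.injEq, add_left_inj] at hij; exact Prod.ext hij.1 hij.2).mul_left
    (r' - r)⁻¹
  refine .of_nonneg_of_le (fun _ => by positivity) (fun i => ?_) h
  have e := succ_mul_pow_mul_le h0 hδ.le i.1
  rw [add_sub_cancel] at e
  change _ ≤ (r' - r)⁻¹ * (‖cf f (i.1 + 1) i.2‖ * r' ^ (i.1 + 1 + i.2))
  rw [cf_dz, norm_mul, pow_add, pow_add r' (i.1 + 1),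
    show ((i.1 : ℂ) + 1) = ((i.1 + 1 : ℕ) : ℂ) by push_cast; rfl, Complex.norm_natCast]
  have h4 : r ^ i.2 ≤ r' ^ i.2 := by gcongr
  have h5 : 0 ≤ r' := h0.trans h2.le
  push_cast
  calc (i.1 + 1) * ‖cf f (i.1 + 1) i.2‖ * (r ^ i.1 * r ^ i.2)
      = (r' - r)⁻¹ * (‖cf f (i.1 + 1) i.2‖ * (((i.1 + 1) * r ^ i.1 * (r' - r)) * r ^ i.2)) := by
        field_simp
    _ ≤ (r' - r)⁻¹ * (‖cf f (i.1 + 1) i.2‖ * (r' ^ (i.1 + 1) * r' ^ i.2)) := by gcongr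

/-- Exchange of the variables. -/
def flip (f : DoubleSeries) : DoubleSeries := ofCf fun m n => cf f n m

@[simp] lemma cf_flip (m n : ℕ) : cf (flip f) m n = cf f n m := cf_ofCf _ _ _

lemma dζ_eq_flip (f : DoubleSeries) : dζ f = flip (DoubleSeries.dz (flip f)) :=
  ext_cf fun m n => by simp [cf_dz, cf_dζ]

lemma Converges.flip (hf : Converges ρ f) : Converges ρ (flip f) := fun r h0 h1 => by
  simpa only [cf_flip, add_comm, Prod.fst_swap, Prod.snd_swap, Function.comp_def,
    Equiv.prodComm_apply] using
    (Equiv.prodComm ℕ ℕ).summable_iff.2 (hf r h0 h1)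

lemma Converges.dζ (hf : Converges ρ f) : Converges ρ (dζ f) := by
  rw [dζ_eq_flip]; exact hf.flip.dz.flip

lemma Converges.iterate_dζ (hf : Converges ρ f) (β : ℕ) :
    Converges ρ (DoubleSeries.dζ^[β] f) := by
  induction β with
  | zero => exact hf
  | succ n ih => rw [Function.iterate_succ_apply']; exact ih.dζ

lemma Converges.dd (hf : Converges ρ f) (α β : ℕ) : Converges ρ (dd α β f) := by
  rw [DoubleSeries.dd]
  induction α with
  | zero => exact hf.iterate_dζ β
  | succ n ih => rw [Function.iterate_succ_apply']; exact ih.dz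

/-- The derivative of a monomial. -/
def monomialFDeriv (c : ℂ) (i : ℕ × ℕ) (p : ℂ × ℂ) : ℂ × ℂ →L[ℂ] ℂ :=
  (c * (i.1 * p.1 ^ (i.1 - 1)) * p.2 ^ i.2) • ContinuousLinearMap.fst ℂ ℂ ℂ +
    (c * p.1 ^ i.1 * (i.2 * p.2 ^ (i.2 - 1))) • ContinuousLinearMap.snd ℂ ℂ ℂ

lemma hasFDerivAt_monomial (c : ℂ) (i : ℕ × ℕ) (p : ℂ × ℂ) :
    HasFDerivAt (fun p : ℂ × ℂ => c * p.1 ^ i.1 * p.2 ^ i.2) (monomialFDeriv c i p) p := by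
  have h1 : HasFDerivAt (fun p : ℂ × ℂ => p.1 ^ i.1) _ p := (hasFDerivAt_fst (𝕜 := ℂ)).pow i.1
  have h2 : HasFDerivAt (fun p : ℂ × ℂ => p.2 ^ i.2) _ p := (hasFDerivAt_snd (𝕜 := ℂ)).pow i.2
  refine ((h1.const_mul c).mul h2).congr_fderiv ?_
  ext
  · simp [monomialFDeriv]
    ring
  · simp [monomialFDeriv, mul_assoc]

lemma hasSum_dz (hf : Converges ρ f) (hp : ‖p‖ < ρ) :
    HasSum (fun i : ℕ × ℕ => cf f i.1 i.2 * (i.1 * p.1 ^ (i.1 - 1)) * p.2 ^ i.2)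
      (ev (dz f) p) := by
  have h := hf.dz.hasSum hp
  have hi : Function.Injective fun i : ℕ × ℕ => (i.1 + 1, i.2) := fun i j hij => by
      simp only [Prod.mk.injEq, add_left_inj] at hij; exact Prod.ext hij.1 hij.2
  refine (hi.hasSum_iff ?_).1 ?_
  · rintro ⟨m, n⟩ hmn
    rcases m with _ | m
    · simp
    · exact absurd ⟨(m, n), rfl⟩ hmn
  · convert h using 2 with i
    simp only [cf_dz, Function.comp_apply, Nat.add_sub_cancel]
    push_cast; ring

lemma ev_flip (f : DoubleSeries) (p : ℂ × ℂ) : ev (flip f) p = ev f p.swap := by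
  rw [ev, ev, ← (Equiv.prodComm ℕ ℕ).tsum_eq]
  refine tsum_congr fun i => ?_
  simp; ring

lemma hasSum_dζ (hf : Converges ρ f) (hp : ‖p‖ < ρ) :
    HasSum (fun i : ℕ × ℕ => cf f i.1 i.2 * p.1 ^ i.1 * (i.2 * p.2 ^ (i.2 - 1)))
      (ev (dζ f) p) := by
  have hp' : ‖p.swap‖ < ρ := by rwa [Prod.norm_def, max_comm, Prod.fst_swap, Prod.snd_swap]
  have h := (Equiv.prodComm ℕ ℕ).hasSum_iff.2 (hasSum_dz hf.flip hp')
  rw [dζ_eq_flip, ev_flip]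
  convert h using 2 with i
  simp; ring

/-- Termwise differentiation: on the ball of radius r the derivatives of the monomials are dominated
by the differentiated series at (r, r). -/
theorem hasFDerivAt_ev (hf : Converges ρ f) (hp : ‖p‖ < ρ) :
    HasFDerivAt (ev f) (ev (dz f) p • ContinuousLinearMap.fst ℂ ℂ ℂ +
      ev (dζ f) p • ContinuousLinearMap.snd ℂ ℂ ℂ) p := by
  obtain ⟨r, h1, h2⟩ := exists_between hp
  have h0 : 0 ≤ r := (norm_nonneg _).trans h1.le
  have hr : ‖((r : ℂ), (r : ℂ))‖ < ρ := by simpa [Prod.norm_def, abs_of_nonneg h0] using h2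
  have hu := (hasSum_dz hf hr).summable.norm.add (hasSum_dζ hf hr).summable.norm
  have hb : ∀ (i : ℕ × ℕ), ∀ x ∈ Metric.ball (0 : ℂ × ℂ) r,
      ‖monomialFDeriv (cf f i.1 i.2) i x‖ ≤
      ‖cf f i.1 i.2 * (i.1 * (r : ℂ) ^ (i.1 - 1)) * (r : ℂ) ^ i.2‖ +
      ‖cf f i.1 i.2 * (r : ℂ) ^ i.1 * (i.2 * (r : ℂ) ^ (i.2 - 1))‖ := by
    intro i x hx
    rw [mem_ball_zero_iff] at hx
    have e1 : ‖x.1‖ ≤ r := (norm_fst_le x).trans hx.le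
    have e2 : ‖x.2‖ ≤ r := (norm_snd_le x).trans hx.le
    refine (norm_add_le _ _).trans (add_le_add ?_ ?_)
    · rw [norm_smul]
      refine (mul_le_of_le_one_right (norm_nonneg _) (ContinuousLinearMap.norm_fst_le _ _ _)).trans ?_
      simp only [norm_mul, norm_pow, Complex.norm_real, Real.norm_of_nonneg h0]
      gcongr
    · rw [norm_smul]
      refine (mul_le_of_le_one_right (norm_nonneg _) (ContinuousLinearMap.norm_snd_le _ _ _)).trans ?_
      simp only [norm_mul, norm_pow, Complex.norm_real, Real.norm_of_nonneg h0]
      gcongr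
  have hp' : p ∈ Metric.ball (0 : ℂ × ℂ) r := mem_ball_zero_iff.2 h1
  have h := hasFDerivAt_tsum_of_isPreconnected hu Metric.isOpen_ball
    (convex_ball _ _).isPreconnected (fun i x _ => hasFDerivAt_monomial (cf f i.1 i.2) i x) hb hp'
    (hf.hasSum hp).summable hp'
  refine h.congr_fderiv (HasSum.tsum_eq ?_)
  exact ((hasSum_dz hf hp).smul_const _).add ((hasSum_dζ hf hp).smul_const _)

lemma differentiableOn_ev (hf : Converges ρ f) : DifferentiableOn ℂ (ev f) (Metric.ball 0 ρ) :=
  fun _ hp => (hasFDerivAt_ev hf (mem_ball_zero_iff.1 hp)).differentiableAt.differentiableWithinAt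

lemma hasDerivAt_ev_fst (hf : Converges ρ f) {z ζ : ℂ} (hz : ‖z‖ < ρ) (hζ : ‖ζ‖ < ρ) :
    HasDerivAt (fun z => ev f (z, ζ)) (ev (dz f) (z, ζ)) z := by
  have hp : ‖(z, ζ)‖ < ρ := max_lt hz hζ
  refine ((hasFDerivAt_ev hf hp).comp_hasDerivAt z
    ((hasDerivAt_id z).prodMk (hasDerivAt_const z ζ))).congr_deriv ?_
  simp

lemma hasDerivAt_ev_snd (hf : Converges ρ f) {z ζ : ℂ} (hz : ‖z‖ < ρ) (hζ : ‖ζ‖ < ρ) :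
    HasDerivAt (fun ζ => ev f (z, ζ)) (ev (dζ f) (z, ζ)) ζ := by
  have hp : ‖(z, ζ)‖ < ρ := max_lt hz hζ
  refine ((hasFDerivAt_ev hf hp).comp_hasDerivAt ζ
    ((hasDerivAt_const ζ z).prodMk (hasDerivAt_id ζ))).congr_deriv ?_
  simp

lemma iteratedDeriv_snd (hf : Converges ρ f) {F : ℂ × ℂ → ℂ}
    (hF : ∀ p, ‖p‖ < ρ → F p = ev f p) (β : ℕ) {z ζ : ℂ} (hz : ‖z‖ < ρ) (hζ : ‖ζ‖ < ρ) :
    iteratedDeriv β (fun ζ => F (z, ζ)) ζ = ev (dζ^[β] f) (z, ζ) := by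
  induction β generalizing ζ with
  | zero => simpa using hF _ (max_lt hz hζ)
  | succ n ih =>
    have h : iteratedDeriv n (fun ζ => F (z, ζ)) =ᶠ[nhds ζ] fun ζ => ev (dζ^[n] f) (z, ζ) := by
      filter_upwards [continuous_norm.tendsto ζ |>.eventually_lt_const hζ] with x hx using ih hx
    rw [iteratedDeriv_succ, h.deriv_eq, Function.iterate_succ_apply']
    exact (hasDerivAt_ev_snd (hf.iterate_dζ n) hz hζ).deriv

/-- This links the iterated derivatives in the statement to formal ones. Equality of F with the sum
on the ball suffices, because derivatives are local. -/
theorem partialDeriv_eq_ev (hf : Converges ρ f) {F : ℂ × ℂ → ℂ}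
    (hF : ∀ p, ‖p‖ < ρ → F p = ev f p) (α β : ℕ) (hp : ‖p‖ < ρ) :
    partialDeriv α β F p = ev (dd α β f) p := by
  obtain ⟨z, ζ⟩ := p
  have hζ : ‖ζ‖ < ρ := (norm_snd_le (z, ζ)).trans_lt hp
  have hz : ‖z‖ < ρ := (norm_fst_le (z, ζ)).trans_lt hp
  rw [partialDeriv]
  change iteratedDeriv α (fun z => iteratedDeriv β (fun ζ => F (z, ζ)) ζ) z = _
  clear hp
  induction α generalizing z with
  | zero => exact iteratedDeriv_snd hf hF β hz hζ
  | succ n ih =>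
    have h : iteratedDeriv n (fun z => iteratedDeriv β (fun ζ => F (z, ζ)) ζ) =ᶠ[nhds z]
        fun z => ev (dd n β f) (z, ζ) := by
      filter_upwards [continuous_norm.tendsto z |>.eventually_lt_const hz] with x hx using ih x hx
    rw [iteratedDeriv_succ, h.deriv_eq, ← dz_dd]
    exact (hasDerivAt_ev_fst (hf.dd n β) hz hζ).deriv

lemma ev_zero_eq (f : DoubleSeries) : ev f 0 = cf f 0 0 := by
  rw [ev, tsum_eq_single (0, 0)]
  · simp
  · rintro ⟨m, n⟩ h
    rcases m with _ | m
    · rcases n with _ | n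
      · exact absurd rfl h
      · simp
    · simp

/-- The coefficients of a convergent double power series are determined by its sum. -/
theorem eq_of_ev_eq (hρ : 0 < ρ) (hf : Converges ρ f) (hg : Converges ρ g)
    (h : ∀ p, ‖p‖ < ρ → ev f p = ev g p) : f = g := by
  refine ext_cf fun m n => ?_
  have h0 : ‖(0 : ℂ × ℂ)‖ < ρ := by simpa
  have e := (partialDeriv_eq_ev hf (fun _ _ => rfl) m n h0).symm.trans
    (partialDeriv_eq_ev hg h m n h0)
  rw [ev_zero_eq, ev_zero_eq, cf_dd, cf_dd] at e
  simp only [zero_add] at e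
  refine mul_left_cancel₀ (mul_ne_zero ?_ ?_) e <;>
    exact Nat.cast_ne_zero.2 (Nat.ascFactorial_pos _ _).ne'

end DoubleSeries

end AnalyticSymbols

/-! ### From the Banach algebra to analytic symbols -/

namespace AnalyticSymbols

open Finset PowerSeries DoubleSeries WeylSeries

namespace DoubleSeries

variable {f : DoubleSeries} {A B : ℝ}

lemma hasSum_geometric_prod {x y : ℝ} (hx : 0 ≤ x) (hx1 : x < 1) (hy : 0 ≤ y) (hy1 : y < 1) :
    HasSum (fun i : ℕ × ℕ => x ^ i.1 * y ^ i.2) ((1 - x)⁻¹ * (1 - y)⁻¹) :=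
  (hasSum_geometric_of_lt_one hx hx1).mul (hasSum_geometric_of_lt_one hy hy1)
    ((summable_geometric_of_lt_one hx hx1).mul_of_nonneg (summable_geometric_of_lt_one hy hy1)
      (fun _ => by positivity) fun _ => by positivity)

lemma converges_of_norm_cf_le (hB : 0 < B) (h : ∀ m n, ‖cf f m n‖ ≤ A * B ^ (m + n)) :
    Converges B⁻¹ f := by
  intro r h0 h1
  have h2 : B * r < 1 := by rwa [mul_comm, ← lt_div_iff₀ hB, one_div]
  have h3 : 0 ≤ B * r := by positivity
  refine .of_nonneg_of_le (fun _ => by positivity) (fun i => ?_)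
    ((hasSum_geometric_prod h3 h2 h3 h2).summable.mul_left A)
  refine (mul_le_mul_of_nonneg_right (h i.1 i.2) (by positivity)).trans_eq ?_
  rw [← pow_add, mul_pow, mul_assoc]

lemma norm_ev_le (hB : 0 < B) (h : ∀ m n, ‖cf f m n‖ ≤ A * B ^ (m + n)) {p : ℂ × ℂ}
    (hp : B * ‖p‖ ≤ 1 / 2) : ‖ev f p‖ ≤ 4 * A := by
  have hs := (hasSum_geometric_prod (x := 1 / 2) (y := 1 / 2) (by norm_num) (by norm_num)
    (by norm_num) (by norm_num)).mul_left A
  have hA : 0 ≤ A := by simpa using (norm_nonneg _).trans (h 0 0)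
  refine (tsum_of_norm_bounded hs fun i => ?_).trans_eq (by norm_num; ring)
  refine (norm_term_le le_rfl i).trans ?_
  refine (mul_le_mul_of_nonneg_right (h i.1 i.2) (by positivity)).trans ?_
  rw [← pow_add, mul_assoc, ← mul_pow]
  gcongr

end DoubleSeries

namespace WeylSeries

/-- On a polydisc of convergence the Weyl composition of the sums is the sum of the product. -/
theorem weylMul_eq_ev {ρ : ℝ} {a b : WeylSeries} (ha : ∀ k, Converges ρ (a k))
    (hb : ∀ k, Converges ρ (b k)) {F H : FormalSymbol (ℂ × ℂ)}
    (hF : ∀ k p, ‖p‖ < ρ → F k p = ev (a k) p) (hH : ∀ k p, ‖p‖ < ρ → H k p = ev (b k) p)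
    (k : ℕ) {p : ℂ × ℂ} (hp : ‖p‖ < ρ) : weylMul F H k p = ev ((a * b) k) p := by
  have h1 : ∀ (s t : ℕ × ℕ), Converges ρ (wc s • (dd s.2 s.1 (a t.1) * dd s.1 s.2 (b t.2))) :=
    fun s t => (((ha _).dd _ _).mul ((hb _).dd _ _)).smul _
  have h2 : ∀ (n : ℕ) (t : ℕ × ℕ), Converges ρ (bidiff n (a t.1) (b t.2)) :=
    fun n t => Converges.sum fun s _ => h1 s t
  have h3 : ∀ d : ℕ × ℕ, Converges ρ (∑ t ∈ antidiagonal d.2, bidiff d.1 (a t.1) (b t.2)) :=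
    fun d => Converges.sum fun t _ => h2 d.1 t
  have e1 : ∀ (s t : ℕ × ℕ), ev (wc s • (dd s.2 s.1 (a t.1) * dd s.1 s.2 (b t.2))) p =
      wc s * (partialDeriv s.2 s.1 (F t.1) p * partialDeriv s.1 s.2 (H t.2) p) := fun s t => by
    rw [ev_smul, ev_mul ((ha _).dd _ _) ((hb _).dd _ _) hp,
      partialDeriv_eq_ev (ha t.1) (hF t.1) _ _ hp, partialDeriv_eq_ev (hb t.2) (hH t.2) _ _ hp]
  have e2 : ∀ (n : ℕ) (t : ℕ × ℕ), ev (bidiff n (a t.1) (b t.2)) p = ∑ s ∈ antidiagonal n,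
      wc s * (partialDeriv s.2 s.1 (F t.1) p * partialDeriv s.1 s.2 (H t.2) p) := fun n t => by
    rw [bidiff, ev_sum (fun s _ => h1 s t) hp]
    exact Finset.sum_congr rfl fun s _ => e1 s t
  rw [mul_apply, ev_sum (fun d _ => h3 d) hp]
  unfold weylMul
  refine Finset.sum_congr rfl fun d _ => ?_
  rw [ev_sum (fun t _ => h2 d.1 t) hp, Finset.sum_comm]
  refine Finset.sum_congr rfl fun t _ => ?_
  rw [e2]
  rfl

end WeylSeries

namespace WeylAlgebra

/-- The inverse weight is k! times two binomial coefficients, divided by 4. The exponential part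
affects only radii and constants, while k! is the growth in k allowed for analytic symbols. -/
lemma inv_bk_le (k m n : ℕ) : (4 * bk k m n)⁻¹ ≤ k.factorial * 2 ^ (2 * k + m + n) := by
  have h1 : ((k + m).factorial : ℝ) ≤ 2 ^ (k + m) * (k.factorial * m.factorial) := by
    rw [← Nat.add_choose_mul_factorial_mul_factorial k m, mul_assoc]
    push_cast
    gcongr
    exact_mod_cast Nat.choose_le_two_pow _ _
  have h2 : ((k + n).factorial : ℝ) ≤ 2 ^ (k + n) * (k.factorial * n.factorial) := by
    rw [← Nat.add_choose_mul_factorial_mul_factorial k n, mul_assoc]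
    push_cast
    gcongr
    exact_mod_cast Nat.choose_le_two_pow _ _
  have hb : (bk k m n)⁻¹ ≤ k.factorial * 2 ^ (2 * k + m + n) := by
    rw [bk, inv_div, div_le_iff₀ (by positivity)]
    refine (mul_le_mul h1 h2 (by positivity) (by positivity)).trans_eq ?_
    rw [two_mul, show k + k + m + n = (k + m) + (k + n) by ring, pow_add _ (k + m)]
    ring
  refine le_trans ?_ hb
  have := bk_pos k m n
  gcongr
  linarith

variable {t : ℝ}

/-- The symbol with Taylor coefficients `t ^ (-(2k + m + n)) x_{kmn}`. -/
def sym (t : ℝ) (x : WeylAlgebra) : FormalSymbol (ℂ × ℂ) :=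
  fun k p => ev (scale (t : ℂ)⁻¹ x.1 k) p

lemma norm_cf_scale_le (ht : 0 < t) (x : WeylAlgebra) (k m n : ℕ) :
    ‖cf (scale (t : ℂ)⁻¹ x.1 k) m n‖ ≤
      (k.factorial * (4 / t ^ 2) ^ k * ‖x‖) * (2 / t) ^ (m + n) := by
  rw [cf_scale, norm_mul, norm_pow, norm_inv, Complex.norm_real, Real.norm_of_nonneg ht.le]
  refine (mul_le_mul_of_nonneg_left ((norm_cf_le x k m n).trans
    (mul_le_mul_of_nonneg_right (inv_bk_le k m n) (norm_nonneg _))) (by positivity)).trans_eq ?_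
  rw [show (4 / t ^ 2) = (2 / t) ^ 2 by ring, ← pow_mul, div_eq_mul_inv, mul_pow, mul_pow,
    add_assoc (2 * k), pow_add, pow_add]
  ring

/-- The coefficient bound would allow radius t/2; on t/4 the geometric ratios are at most 1/2, as
`norm_ev_le` requires. -/
lemma converges_scale (ht : 0 < t) (x : WeylAlgebra) (k : ℕ) :
    Converges (t / 4) (scale (t : ℂ)⁻¹ x.1 k) := by
  have := converges_of_norm_cf_le (by positivity) (norm_cf_scale_le ht x k)
  intro r h0 h1
  refine this r h0 (h1.trans_le ?_)
  rw [inv_div]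
  linarith

lemma norm_sym_le (ht : 0 < t) (x : WeylAlgebra) (k : ℕ) {p : ℂ × ℂ} (hp : ‖p‖ < t / 4) :
    ‖sym t x k p‖ ≤ 4 * (k.factorial * (4 / t ^ 2) ^ k * ‖x‖) := by
  refine norm_ev_le (by positivity) (norm_cf_scale_le ht x k) ?_
  rw [div_mul_eq_mul_div, div_le_iff₀ ht]
  linarith

lemma norm_sym_le_pow (ht : 0 < t) (x : WeylAlgebra) (k : ℕ) {p : ℂ × ℂ} (hp : ‖p‖ < t / 4) :
    ‖sym t x k p‖ ≤ (4 * ‖x‖ + 4 / t ^ 2) ^ (k + 1) * (k : ℝ) ^ k := by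
  refine (norm_sym_le ht x k hp).trans ?_
  have h1 : (k.factorial : ℝ) ≤ (k : ℝ) ^ k := by exact_mod_cast Nat.factorial_le_pow k
  have h2 : (4 / t ^ 2) ^ k ≤ (4 * ‖x‖ + 4 / t ^ 2) ^ k :=
    pow_le_pow_left₀ (by positivity) (by linarith [norm_nonneg x]) k
  have h3 : 4 * ‖x‖ ≤ 4 * ‖x‖ + 4 / t ^ 2 := by linarith [show 0 ≤ 4 / t ^ 2 by positivity]
  calc 4 * (k.factorial * (4 / t ^ 2) ^ k * ‖x‖) = (4 / t ^ 2) ^ k * (4 * ‖x‖) * k.factorial := by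
        ring
    _ ≤ (4 * ‖x‖ + 4 / t ^ 2) ^ k * (4 * ‖x‖ + 4 / t ^ 2) * (k : ℝ) ^ k := by gcongr
    _ = _ := by rw [pow_succ _ k]

lemma differentiableOn_sym (ht : 0 < t) (x : WeylAlgebra) (k : ℕ) :
    DifferentiableOn ℂ (sym t x k) (Metric.ball 0 (t / 4)) :=
  differentiableOn_ev (converges_scale ht x k)

lemma isAnalyticSymbol_sym (ht : 0 < t) (x : WeylAlgebra) {V : Set (ℂ × ℂ)}
    (hV : V ⊆ Metric.ball 0 (t / 4)) : IsAnalyticSymbol V (sym t x) := by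
  refine ⟨fun k => (differentiableOn_sym ht x k).mono hV, fun K hK _ =>
    ⟨4 * ‖x‖ + 4 / t ^ 2, by positivity, fun k p hp => ?_⟩⟩
  exact norm_sym_le_pow ht x k (mem_ball_zero_iff.1 (hV (hK hp)))

lemma weylMul_eq_sym (ht : 0 < t) {x y : WeylAlgebra} {F H : FormalSymbol (ℂ × ℂ)}
    (hF : ∀ k p, ‖p‖ < t / 4 → F k p = sym t x k p)
    (hH : ∀ k p, ‖p‖ < t / 4 → H k p = sym t y k p) (k : ℕ) {p : ℂ × ℂ} (hp : ‖p‖ < t / 4) :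
    weylMul F H k p = sym t (x * y) k p := by
  rw [weylMul_eq_ev (converges_scale ht x) (converges_scale ht y) hF hH k hp, sym, coe_mul, map_mul]

lemma sym_one (k : ℕ) (p : ℂ × ℂ) : sym t 1 k p = if k = 0 then 1 else 0 := by
  rw [sym, coe_one, map_one, one_apply, ev, tsum_eq_single (0, 0)]
  · split_ifs <;> simp [cf_one]
  · rintro ⟨m, n⟩ h
    split_ifs
    · rw [cf_one, if_neg (by rintro ⟨rfl, rfl⟩; exact h rfl)]; simp
    · simp

lemma weylPow_eq_sym (ht : 0 < t) {x : WeylAlgebra} {F : FormalSymbol (ℂ × ℂ)}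
    (hF : ∀ k p, ‖p‖ < t / 4 → F k p = sym t x k p) (n k : ℕ) {p : ℂ × ℂ} (hp : ‖p‖ < t / 4) :
    weylPow F n k p = sym t (x ^ n) k p := by
  induction n generalizing k p with
  | zero => rw [pow_zero, sym_one]; rfl
  | succ n ih =>
    rw [pow_succ]
    exact weylMul_eq_sym ht (fun k p hp => ih k hp) hF k hp

/-- Evaluation of a coefficient of the symbol as a continuous linear functional. -/
lemma exists_sym_eq (ht : 0 < t) (k : ℕ) {p : ℂ × ℂ} (hp : ‖p‖ < t / 4) :
    ∃ L : WeylAlgebra →L[ℂ] ℂ, ‖L‖ ≤ 4 * (k.factorial * (4 / t ^ 2) ^ k) ∧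
      ∀ x, L x = sym t x k p := by
  let L : WeylAlgebra →ₗ[ℂ] ℂ :=
    { toFun := fun x => sym t x k p
      map_add' := fun x y => by
        rw [sym, coe_add, map_add, add_apply,
          ev_add (converges_scale ht x k) (converges_scale ht y k) hp]
        rfl
      map_smul' := fun c x => by
        rw [sym, coe_smul, map_smul, smul_apply, ev_smul]
        rfl }
  have hL : ∀ x, ‖L x‖ ≤ 4 * (k.factorial * (4 / t ^ 2) ^ k) * ‖x‖ := fun x => by
    rw [mul_assoc]
    exact norm_sym_le ht x k hp
  exact ⟨L.mkContinuous _ hL, L.mkContinuous_norm_le (by positivity) hL, fun _ => rfl⟩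

/-- Evaluation at p of the h^k coefficient is a functional bounded uniformly in p, so norm
convergence of the exponential series becomes uniform convergence. -/
theorem isWeylExp_sym (ht : 0 < t) {x : WeylAlgebra} {F : FormalSymbol (ℂ × ℂ)}
    (hF : ∀ k p, ‖p‖ < t / 4 → F k p = sym t x k p) {V : Set (ℂ × ℂ)}
    (hV : V ⊆ Metric.ball 0 (t / 4)) : IsWeylExp V F (sym t (NormedSpace.exp x)) := by
  intro k
  refine HasSumUniformlyOn.hasSumLocallyUniformlyOn
    (hasSumUniformlyOn_iff_tendstoUniformlyOn.2 (Metric.tendstoUniformlyOn_iff.2 fun ε hε => ?_))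
  set M := 4 * (k.factorial * (4 / t ^ 2) ^ k) with hM
  have hM0 : 0 < M := by positivity
  have h := Metric.tendsto_nhds.1 (NormedSpace.exp_series_hasSum_exp' (𝕂 := ℂ) x) (ε / M)
    (by positivity)
  filter_upwards [h] with s hs p hp
  have hp' := mem_ball_zero_iff.1 (hV hp)
  obtain ⟨L, hL, hLs⟩ := exists_sym_eq ht k hp'
  have e : ∑ n ∈ s, ((n.factorial : ℂ))⁻¹ * weylPow F n k p =
      L (∑ n ∈ s, (n.factorial : ℂ)⁻¹ • x ^ n) := by
    rw [map_sum]
    refine Finset.sum_congr rfl fun n _ => ?_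
    rw [map_smul, hLs, weylPow_eq_sym ht hF n k hp', smul_eq_mul]
  rw [e, ← hLs, dist_comm, dist_eq_norm, ← map_sub]
  rw [dist_eq_norm] at hs
  calc _ ≤ ‖L‖ * _ := L.le_opNorm _
    _ ≤ M * _ := mul_le_mul_of_nonneg_right hL (norm_nonneg _)
    _ < M * (ε / M) := by gcongr
    _ = ε := by field_simp

lemma sym_neg (ht : 0 < t) (x : WeylAlgebra) (k : ℕ) {p : ℂ × ℂ} (hp : ‖p‖ < t / 4) :
    (-sym t x) k p = sym t (-x) k p := by
  obtain ⟨L, -, hL⟩ := exists_sym_eq ht k hp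
  rw [← hL, map_neg, hL]
  rfl

/-- The symbol of an element with diagonal Taylor coefficients is a function of `z ζ`. -/
lemma sym_eq_of_mul_eq {x : WeylAlgebra} (hx : ∀ k m n, m ≠ n → coefL k m n x = 0)
    (k : ℕ) {p p' : ℂ × ℂ} (h : p.1 * p.2 = p'.1 * p'.2) : sym t x k p = sym t x k p' := by
  refine tsum_congr fun ⟨m, n⟩ => ?_
  rcases eq_or_ne m n with rfl | hmn
  · simp only [mul_assoc, ← mul_pow, h]
  · have := hx k m n hmn
    rw [coefL_apply] at this
    simp [this]

end WeylAlgebra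

end AnalyticSymbols

/-! ### Taylor expansion of holomorphic functions of two variables -/

namespace AnalyticSymbols

open Finset PowerSeries DoubleSeries WeylSeries

/-- The `m`-th Taylor coefficient at the origin. -/
def taylorCoeff (m : ℕ) (f : ℂ → ℂ) : ℂ := (m.factorial : ℂ)⁻¹ * iteratedDeriv m f 0

section OneVariable

variable {f : ℂ → ℂ} {R M : ℝ}

lemma norm_taylorCoeff_le (hR : 0 < R) (hf : DifferentiableOn ℂ f (Metric.ball 0 R))
    (hM : ∀ z, ‖z‖ < R → ‖f z‖ ≤ M) (m : ℕ) : ‖taylorCoeff m f‖ ≤ M * (2 / R) ^ m := by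
  have h := Complex.norm_iteratedDeriv_le_of_forall_mem_sphere_norm_le (c := 0) (R := R / 2)
    (C := M) m (by positivity)
    (hf.diffContOnCl_ball (Metric.closedBall_subset_ball (by linarith)))
    fun z hz => hM z (by rw [mem_sphere_zero_iff_norm.1 hz]; linarith)
  rw [taylorCoeff, norm_mul, norm_inv, Complex.norm_natCast]
  refine (mul_le_mul_of_nonneg_left h (by positivity)).trans_eq ?_
  have : (m.factorial : ℝ) ≠ 0 := by positivity
  rw [div_pow, div_pow]
  field_simp

lemma hasSum_taylorCoeff (hf : DifferentiableOn ℂ f (Metric.ball 0 R)) {z : ℂ} (hz : ‖z‖ < R) :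
    HasSum (fun m => taylorCoeff m f * z ^ m) (f z) := by
  refine hasSum_of_forall_eq
    (Complex.hasSum_taylorSeries_on_ball hf (mem_ball_zero_iff.2 hz)) fun m => ?_
  simp only [taylorCoeff, sub_zero, smul_eq_mul]
  ring

end OneVariable

section TwoVariables

variable {f : ℂ × ℂ → ℂ} {R M : ℝ}

/-- Remainder estimate for the Taylor expansion in the first variable. -/
lemma norm_sub_sum_taylorCoeff_le (hR : 0 < R) {f : ℂ → ℂ}
    (hf : DifferentiableOn ℂ f (Metric.ball 0 R)) (hM : ∀ z, ‖z‖ < R → ‖f z‖ ≤ M) (m : ℕ) {z : ℂ}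
    (hz : ‖z‖ < R / 4) :
    ‖f z - ∑ i ∈ range m, taylorCoeff i f * z ^ i‖ ≤ 2 * M * (2 / R * ‖z‖) ^ m := by
  have h := (hasSum_nat_add_iff' m).2 (hasSum_taylorCoeff hf (hz.trans (by linarith)))
  have hM0 : 0 ≤ M := (norm_nonneg _).trans (hM 0 (by simpa))
  have hx : 2 / R * ‖z‖ ≤ 1 / 2 := by
    rw [div_mul_eq_mul_div, div_le_iff₀ hR]; linarith
  have hg := hasSum_geometric_two.mul_left (M * (2 / R * ‖z‖) ^ m)
  rw [← h.tsum_eq]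
  refine (tsum_of_norm_bounded hg fun i => ?_).trans_eq (by ring)
  rw [norm_mul, norm_pow, pow_add, mul_assoc]
  calc _ ≤ M * (2 / R) ^ (i + m) * (‖z‖ ^ i * ‖z‖ ^ m) :=
        mul_le_mul_of_nonneg_right (norm_taylorCoeff_le hR hf hM _) (by positivity)
    _ = M * (2 / R * ‖z‖) ^ m * (2 / R * ‖z‖) ^ i := by rw [mul_pow, mul_pow, pow_add]; ring
    _ ≤ M * (2 / R * ‖z‖) ^ m * (1 / 2) ^ i := by gcongr
    _ = _ := by ring

/-- The Taylor coefficients in one variable depend holomorphically on the other one. -/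
lemma differentiableOn_taylorCoeff (hR : 0 < R)
    (hf : DifferentiableOn ℂ f (Metric.ball 0 R)) (hM : ∀ p, ‖p‖ < R → ‖f p‖ ≤ M) (m : ℕ) :
    DifferentiableOn ℂ (fun ζ => taylorCoeff m fun z => f (z, ζ)) (Metric.ball 0 R) := by
  induction m using Nat.strong_induction_on with
  | _ m ih =>
  have h1 : ∀ ζ ∈ Metric.ball (0 : ℂ) R,
      DifferentiableOn ℂ (fun z => f (z, ζ)) (Metric.ball 0 R) := fun ζ hζ =>
    hf.comp (differentiableOn_id.prodMk (differentiableOn_const _)) fun z hz =>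
      mem_ball_zero_iff.2 (max_lt (mem_ball_zero_iff.1 hz) (mem_ball_zero_iff.1 hζ))
  have h2 : ∀ z ∈ Metric.ball (0 : ℂ) R,
      DifferentiableOn ℂ (fun ζ => f (z, ζ)) (Metric.ball 0 R) := fun z hz =>
    hf.comp ((differentiableOn_const _).prodMk differentiableOn_id) fun ζ hζ =>
      mem_ball_zero_iff.2 (max_lt (mem_ball_zero_iff.1 hz) (mem_ball_zero_iff.1 hζ))
  have hM0 : 0 ≤ M := (norm_nonneg _).trans (hM 0 (by simpa))
  -- The m-th coefficient is the limit, as z → 0 with z ≠ 0, of the order m Taylor remainder divided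
  -- by z^m. These quotients are holomorphic in ζ by induction, and the remainder estimate of order
  -- m + 1 makes the convergence uniform in ζ.
  refine TendstoLocallyUniformlyOn.differentiableOn (φ := nhdsWithin (0 : ℂ) {0}ᶜ)
    (F := fun z ζ => (f (z, ζ) - ∑ i ∈ range m, taylorCoeff i (fun z => f (z, ζ)) * z ^ i) / z ^ m)
    (TendstoUniformlyOn.tendstoLocallyUniformlyOn (Metric.tendstoUniformlyOn_iff.2 fun ε hε => ?_))
    ?_ Metric.isOpen_ball
  · have t1 : Filter.Tendsto (fun z : ℂ => 2 * M * (2 / R) ^ (m + 1) * ‖z‖)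
        (nhdsWithin (0 : ℂ) {0}ᶜ) (nhds 0) := by
      have : Filter.Tendsto (fun z : ℂ => 2 * M * (2 / R) ^ (m + 1) * ‖z‖) (nhds 0)
          (nhds (2 * M * (2 / R) ^ (m + 1) * ‖(0 : ℂ)‖)) :=
        (continuous_const.mul continuous_norm).tendsto 0
      rw [norm_zero, mul_zero] at this
      exact this.mono_left nhdsWithin_le_nhds
    have t2 : ∀ᶠ z : ℂ in nhdsWithin (0 : ℂ) {0}ᶜ, ‖z‖ < R / 4 := by
      refine nhdsWithin_le_nhds ?_
      filter_upwards [Metric.ball_mem_nhds (0 : ℂ) (show 0 < R / 4 by positivity)] with z hz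
      exact mem_ball_zero_iff.1 hz
    filter_upwards [t1.eventually_lt_const hε, t2, self_mem_nhdsWithin] with z hz1 hz2 hz3 ζ hζ
    have hz0 : z ≠ 0 := hz3
    have h := norm_sub_sum_taylorCoeff_le hR (h1 ζ hζ)
      (fun z hz => hM (z, ζ) (max_lt hz (mem_ball_zero_iff.1 hζ))) (m + 1) hz2
    refine lt_of_le_of_lt ?_ hz1
    rw [dist_comm, dist_eq_norm]
    have e : (f (z, ζ) - ∑ i ∈ range m, taylorCoeff i (fun z => f (z, ζ)) * z ^ i) / z ^ m -
        taylorCoeff m (fun z => f (z, ζ)) =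
        (f (z, ζ) - ∑ i ∈ range (m + 1), taylorCoeff i (fun z => f (z, ζ)) * z ^ i) / z ^ m := by
      rw [Finset.sum_range_succ]
      field_simp
      ring
    have hzn : 0 < ‖z‖ := norm_pos_iff.2 hz0
    rw [e, norm_div, norm_pow, div_le_iff₀ (by positivity)]
    refine h.trans_eq ?_
    rw [mul_pow, pow_succ ‖z‖]
    ring
  · filter_upwards [nhdsWithin_le_nhds (Metric.ball_mem_nhds (0 : ℂ) hR)] with z hz
    refine ((h2 z hz).sub (DifferentiableOn.fun_sum fun i hi => ?_)).div_const _
    exact (ih i (Finset.mem_range.1 hi)).mul_const _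

/-- The double Taylor series at the origin. -/
def taylorSeries (f : ℂ × ℂ → ℂ) : DoubleSeries :=
  ofCf fun m n => taylorCoeff n fun ζ => taylorCoeff m fun z => f (z, ζ)

lemma norm_cf_taylorSeries_le (hR : 0 < R) (hf : DifferentiableOn ℂ f (Metric.ball 0 R))
    (hM : ∀ p, ‖p‖ < R → ‖f p‖ ≤ M) (m n : ℕ) :
    ‖cf (taylorSeries f) m n‖ ≤ M * (2 / R) ^ (m + n) := by
  rw [taylorSeries, cf_ofCf, pow_add, ← mul_assoc]
  refine norm_taylorCoeff_le hR (differentiableOn_taylorCoeff hR hf hM m) (fun ζ hζ => ?_) n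
  refine norm_taylorCoeff_le hR ?_ (fun z hz => hM (z, ζ) (max_lt hz hζ)) m
  exact hf.comp (differentiableOn_id.prodMk (differentiableOn_const _)) fun z hz =>
    mem_ball_zero_iff.2 (max_lt (mem_ball_zero_iff.1 hz) hζ)

lemma converges_taylorSeries (hR : 0 < R) (hf : DifferentiableOn ℂ f (Metric.ball 0 R))
    (hM : ∀ p, ‖p‖ < R → ‖f p‖ ≤ M) : Converges (R / 2) (taylorSeries f) := by
  have := converges_of_norm_cf_le (by positivity) (norm_cf_taylorSeries_le hR hf hM)
  rwa [inv_div] at this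

theorem ev_taylorSeries (hR : 0 < R) (hf : DifferentiableOn ℂ f (Metric.ball 0 R))
    (hM : ∀ p, ‖p‖ < R → ‖f p‖ ≤ M) {p : ℂ × ℂ} (hp : ‖p‖ < R / 2) :
    ev (taylorSeries f) p = f p := by
  have hp1 : ‖p.1‖ < R := (norm_fst_le p).trans_lt (hp.trans (by linarith))
  have hp2 : ‖p.2‖ < R := (norm_snd_le p).trans_lt (hp.trans (by linarith))
  have h := ((converges_taylorSeries hR hf hM).hasSum hp).prod_fiberwise
    (g := fun m => taylorCoeff m (fun z => f (z, p.2)) * p.1 ^ m) fun m => by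
      refine hasSum_of_forall_eq ((hasSum_taylorCoeff
        (differentiableOn_taylorCoeff hR hf hM m) hp2).mul_right (p.1 ^ m)) fun n => ?_
      change cf (ofCf _) m n * _ * _ = _
      rw [cf_ofCf]
      ring
  refine h.unique (hasSum_taylorCoeff (f := fun z => f (z, p.2)) (R := R) ?_ hp1)
  exact hf.comp (differentiableOn_id.prodMk (differentiableOn_const _)) fun z hz =>
    mem_ball_zero_iff.2 (max_lt (mem_ball_zero_iff.1 hz) hp2)

/-- The Taylor series of a function of `z ζ` is diagonal. -/
theorem cf_taylorSeries_of_comp_mul (hR : 0 < R) (hf : DifferentiableOn ℂ f (Metric.ball 0 R))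
    (hM : ∀ p, ‖p‖ < R → ‖f p‖ ≤ M) {g : ℂ → ℂ} (hg : ∀ p, ‖p‖ < R → f p = g (p.1 * p.2))
    (m n : ℕ) : cf (taylorSeries f) m n = if m = n then taylorCoeff m g else 0 := by
  -- On the slice z = R/2 the function g is recovered from f, so g is holomorphic and bounded by M
  -- on the disc of radius R²/2.
  have key : ∀ w : ℂ, ‖w‖ < R * (R / 2) → g w = f ((R / 2 : ℝ), w / (R / 2 : ℝ)) ∧
      ‖(((R / 2 : ℝ) : ℂ), w / (R / 2 : ℝ))‖ < R := fun w hw => by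
    have h2 : ‖((R / 2 : ℝ) : ℂ)‖ = R / 2 := by
      rw [Complex.norm_real, Real.norm_of_nonneg (by positivity)]
    have h3 : ‖(((R / 2 : ℝ) : ℂ), w / (R / 2 : ℝ))‖ < R := by
      refine max_lt (by rw [h2]; linarith) ?_
      rw [norm_div, h2, div_lt_iff₀ (by positivity)]
      exact hw
    refine ⟨?_, h3⟩
    rw [hg _ h3]
    have : ((R / 2 : ℝ) : ℂ) ≠ 0 := by
      rw [Ne, Complex.ofReal_eq_zero]; positivity
    congr 1
    field_simp
  have hR' : 0 < R * (R / 2) := by positivity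
  have hgd : DifferentiableOn ℂ g (Metric.ball 0 (R * (R / 2))) := by
    refine DifferentiableOn.congr (f := fun w => f ((R / 2 : ℝ), w / (R / 2 : ℝ))) ?_
      fun w hw => (key w (mem_ball_zero_iff.1 hw)).1
    exact hf.comp ((differentiableOn_const _).prodMk (differentiableOn_id.div_const _))
      fun w hw => mem_ball_zero_iff.2 (key w (mem_ball_zero_iff.1 hw)).2
  have hgM : ∀ w, ‖w‖ < R * (R / 2) → ‖g w‖ ≤ M := fun w hw => by
    rw [(key w hw).1]; exact hM _ (key w hw).2
  set D : DoubleSeries := ofCf fun m n => if m = n then taylorCoeff m g else 0 with hD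
  -- Cauchy's estimate for g on that disc has ratio 2/(R²/2) = (2/R)², which matches the bound for
  -- the diagonal exponent m + m.
  have hDb : ∀ m n, ‖cf D m n‖ ≤ M * (2 / R) ^ (m + n) := fun m n => by
    rw [hD, cf_ofCf]
    split_ifs with h
    · subst h
      refine (norm_taylorCoeff_le hR' hgd hgM m).trans_eq ?_
      rw [← two_mul, pow_mul]
      congr 2
      field_simp
    · rw [norm_zero]
      have : 0 ≤ M := (norm_nonneg _).trans (hM 0 (by simpa))
      positivity
  have hDc : Converges (R / 2) D := by
    have := converges_of_norm_cf_le (by positivity) hDb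
    rwa [inv_div] at this
  have : taylorSeries f = D := by
    refine eq_of_ev_eq (ρ := R / 2) (by positivity) (converges_taylorSeries hR hf hM) hDc
      fun p hp => ?_
    rw [ev_taylorSeries hR hf hM hp, hg p (hp.trans (by linarith))]
    have h := (hDc.hasSum hp).prod_fiberwise
      (g := fun m => taylorCoeff m g * (p.1 * p.2) ^ m) fun m => by
        convert hasSum_single m _ using 1
        · simp [hD, mul_pow, mul_assoc]
        · intro n hn
          simp [hD, hn.symm]
    refine (hasSum_taylorCoeff hgd ?_).unique h
    rw [norm_mul]
    have h1 := norm_fst_le p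
    have h2 := norm_snd_le p
    calc ‖p.1‖ * ‖p.2‖ ≤ ‖p‖ * ‖p‖ := by gcongr
      _ < R * (R / 2) := mul_lt_mul'' (hp.trans (by linarith)) hp (norm_nonneg _) (norm_nonneg _)
  rw [this, hD, cf_ofCf]

end TwoVariables

end AnalyticSymbols

/-! ### From analytic symbols to the Banach algebra -/

namespace AnalyticSymbols

open Finset PowerSeries DoubleSeries WeylSeries

open scoped ENNReal

lemma bk_le (k m n : ℕ) : bk k m n ≤ (k.factorial : ℝ)⁻¹ := by
  have h1 : k.factorial * m.factorial ≤ (k + m).factorial :=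
    Nat.le_of_dvd (Nat.factorial_pos _) (Nat.factorial_mul_factorial_dvd_factorial_add k m)
  have h2 : k.factorial * n.factorial ≤ (k + n).factorial :=
    Nat.le_of_dvd (Nat.factorial_pos _) (Nat.factorial_mul_factorial_dvd_factorial_add k n)
  have h := Nat.mul_le_mul h1 h2
  rw [bk, div_le_iff₀ (by positivity), inv_mul_eq_div, le_div_iff₀ (by positivity)]
  refine le_trans (le_of_eq ?_) (Nat.cast_le (α := ℝ).2 h |>.trans_eq (by push_cast; ring))
  push_cast
  ring

/-- After rescaling, the Taylor series of an analytic symbol has finite norm. -/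
lemma nrm_scale_lt_top {a : WeylSeries} {A B t : ℝ} (ht : 0 ≤ t) (hA : 0 ≤ A) (hB : 0 ≤ B)
    (h : ∀ k m n, ‖cf (a k) m n‖ ≤ A ^ (k + 1) * (k : ℝ) ^ k * B ^ (m + n))
    (h1 : A * Real.exp 1 * t ^ 2 ≤ 1 / 2) (h2 : B * t ≤ 1 / 2) : nrm (scale (t : ℂ) a) < ∞ := by
  have key : ∀ k m n : ℕ, wt k m n * ‖cf (scale (t : ℂ) a k) m n‖ₑ ≤
      ENNReal.ofReal (4 * A) * (2⁻¹ ^ k * (2⁻¹ ^ m * 2⁻¹ ^ n)) := fun k m n => by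
    have e2 : (2⁻¹ : ℝ≥0∞) = ENNReal.ofReal (1 / 2) := by
      rw [one_div, ENNReal.ofReal_inv_of_pos two_pos, ENNReal.ofReal_ofNat]
    have hb := bk_pos k m n
    rw [e2, ← ENNReal.ofReal_pow (by norm_num), ← ENNReal.ofReal_pow (by norm_num),
      ← ENNReal.ofReal_pow (by norm_num), ← ENNReal.ofReal_mul (by positivity),
      ← ENNReal.ofReal_mul (by positivity), ← ENNReal.ofReal_mul (by positivity),
      ← ofReal_norm, wt, ← ENNReal.ofReal_mul (by positivity)]
    refine ENNReal.ofReal_le_ofReal ?_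
    rw [cf_scale, norm_mul, norm_pow, Complex.norm_real, Real.norm_of_nonneg ht]
    -- The growth k^k is compensated by the weight, at most 1/k!, up to e^k; this is the source of
    -- the constant e in the condition on t.
    have hk : (k : ℝ) ^ k * (k.factorial : ℝ)⁻¹ ≤ Real.exp 1 ^ k := by
      rw [← div_eq_mul_inv, ← Real.exp_nat_mul, mul_one]
      exact Real.pow_div_factorial_le_exp _ (by positivity) _
    calc 4 * bk k m n * (t ^ (2 * k + m + n) * ‖cf (a k) m n‖)
        ≤ 4 * (k.factorial : ℝ)⁻¹ *
          (t ^ (2 * k + m + n) * (A ^ (k + 1) * (k : ℝ) ^ k * B ^ (m + n))) := by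
          have := bk_le k m n
          have := h k m n
          gcongr
      _ = 4 * A * (((k : ℝ) ^ k * (k.factorial : ℝ)⁻¹) * (A * t ^ 2) ^ k *
          ((B * t) ^ m * (B * t) ^ n)) := by
          rw [mul_pow, mul_pow, mul_pow, ← pow_mul]; ring
      _ ≤ 4 * A * (Real.exp 1 ^ k * (A * t ^ 2) ^ k * ((B * t) ^ m * (B * t) ^ n)) := by gcongr
      _ = 4 * A * ((A * Real.exp 1 * t ^ 2) ^ k * ((B * t) ^ m * (B * t) ^ n)) := by
          rw [← mul_pow,
            show Real.exp 1 * (A * t ^ 2) = A * Real.exp 1 * t ^ 2 by ring]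
      _ ≤ 4 * A * ((1 / 2) ^ k * ((1 / 2) ^ m * (1 / 2) ^ n)) := by gcongr
  refine (ENNReal.tsum_le_tsum fun k => ENNReal.tsum_le_tsum fun m =>
    ENNReal.tsum_le_tsum fun n => key k m n).trans_lt ?_
  simp only [ENNReal.tsum_mul_left, ENNReal.tsum_mul_right, ENNReal.tsum_geometric]
  have : (1 - 2⁻¹ : ℝ≥0∞)⁻¹ < ∞ := by
    rw [ENNReal.one_sub_inv_two, inv_inv]; exact ENNReal.ofNat_lt_top
  exact ENNReal.mul_lt_top ENNReal.ofReal_lt_top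
    (ENNReal.mul_lt_top this (ENNReal.mul_lt_top this this))

/-- An analytic symbol is bounded on a polydisc around the origin. -/
lemma IsAnalyticSymbol.exists_bound {V : Set (ℂ × ℂ)} (hV : IsOpen V) (h0 : (0 : ℂ × ℂ) ∈ V)
    {q : FormalSymbol (ℂ × ℂ)} (hq : IsAnalyticSymbol V q) :
    ∃ R > 0, Metric.ball 0 R ⊆ V ∧ ∃ C > 0, ∀ (k : ℕ) (p : ℂ × ℂ), ‖p‖ < R →
      ‖q k p‖ ≤ C ^ (k + 1) * (k : ℝ) ^ k := by
  obtain ⟨R, hR, hRV⟩ := Metric.nhds_basis_closedBall.mem_iff.1 (hV.mem_nhds h0)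
  obtain ⟨C, hC, h⟩ := hq.2 _ hRV (isCompact_closedBall _ _)
  exact ⟨R, hR, Metric.ball_subset_closedBall.trans hRV, C, hC, fun k p hp =>
    h k p (mem_closedBall_zero_iff.2 hp.le)⟩

open WeylAlgebra in
/-- An analytic symbol is, near the origin, the symbol of an element of the Weyl algebra. -/
lemma IsAnalyticSymbol.exists_sym {V : Set (ℂ × ℂ)} (hV : IsOpen V) (h0 : (0 : ℂ × ℂ) ∈ V)
    {q : FormalSymbol (ℂ × ℂ)} (hq : IsAnalyticSymbol V q) {g : ℂ → ℂ}
    (hg : ∀ p ∈ V, q 0 p = g (p.1 * p.2)) :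
    ∃ (t : ℝ) (Q : WeylAlgebra), 0 < t ∧ Metric.ball 0 t ⊆ V ∧
      (∀ s : ℝ, 0 < s → s ≤ 1 → ∀ (hs : ‖(s : ℂ)‖ ≤ 1) (k : ℕ) (p : ℂ × ℂ), ‖p‖ < t →
        sym (s * t) (scaleL s hs Q) k p = q k p) ∧
      ∀ m n, coefL 0 m n Q = if m = n then (t : ℂ) ^ (2 * m) * taylorCoeff m g else 0 := by
  obtain ⟨R, hR, hRV, C, hC, hb⟩ := hq.exists_bound hV h0
  have hd : ∀ k, DifferentiableOn ℂ (q k) (Metric.ball 0 R) := fun k => (hq.1 k).mono hRV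
  -- The bound with C controls the powers of h. The bound R/4 controls the powers of z and ζ, and
  -- keeps p inside the ball of radius R/2 where the Taylor series represents q.
  obtain ⟨t, ht, ht1, htR, htC⟩ : ∃ t : ℝ, 0 < t ∧ t ≤ 1 ∧ t ≤ R / 4 ∧
      t ≤ (2 * (C * Real.exp 1))⁻¹ :=
    ⟨min 1 (min (R / 4) (2 * (C * Real.exp 1))⁻¹), by positivity, min_le_left _ _,
      (min_le_right _ _).trans (min_le_left _ _), (min_le_right _ _).trans (min_le_right _ _)⟩
  have h1 : C * Real.exp 1 * t ^ 2 ≤ 1 / 2 := by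
    have h3 : t ^ 2 ≤ (2 * (C * Real.exp 1))⁻¹ := (pow_le_of_le_one ht.le ht1 two_ne_zero).trans htC
    refine (mul_le_mul_of_nonneg_left h3 (by positivity)).trans_eq ?_
    field_simp
  have h2 : 2 / R * t ≤ 1 / 2 := by
    rw [div_mul_eq_mul_div, div_le_iff₀ hR]; linarith
  have hn : nrm (scale (t : ℂ) (WeylSeries.mk fun k => taylorSeries (q k))) < ∞ :=
    nrm_scale_lt_top ht.le hC.le (by positivity)
      (fun k m n => norm_cf_taylorSeries_le hR (hd k) (hb k) m n) h1 h2
  refine ⟨t, ⟨_, hn⟩, ht, (Metric.ball_subset_ball (by linarith)).trans hRV, ?_, ?_⟩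
  · intro s hs0 hs1 hs k p hp
    have hst : ((s * t : ℝ) : ℂ)⁻¹ * (s * t) = 1 := by
      rw [← Complex.ofReal_mul]
      exact inv_mul_cancel₀ (Complex.ofReal_ne_zero.2 (mul_pos hs0 ht).ne')
    rw [sym, coe_scaleL]
    change ev (scale _ (scale (s : ℂ) (scale (t : ℂ) _)) k) p = _
    rw [scale_scale (s : ℂ), scale_scale, hst, scale_one, WeylSeries.mk_apply]
    exact ev_taylorSeries hR (hd k) (hb k) (by linarith)
  · intro m n
    rw [coefL_apply]
    change cf (scale (t : ℂ) (WeylSeries.mk fun k => taylorSeries (q k)) 0) m n = _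
    rw [cf_scale, WeylSeries.mk_apply,
      cf_taylorSeries_of_comp_mul hR (hd 0) (hb 0) fun p hp => hg p (hRV (mem_ball_zero_iff.2 hp))]
    split_ifs with h
    · subst h
      rw [mul_zero, zero_add, two_mul]
    · rw [mul_zero]

end AnalyticSymbols

end

/-! ### Assembly of the theorem -/

open AnalyticSymbols AnalyticSymbols.WeylAlgebra

theorem mainTheorem5
    (Ω : Set (ℂ × ℂ)) (hΩ : IsOpen Ω) (h0 : (0 : ℂ × ℂ) ∈ Ω)
    (q : AnalyticSymbols.FormalSymbol (ℂ × ℂ)) (hq : AnalyticSymbols.IsAnalyticSymbol Ω q)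
    (g g₁ : ℂ → ℂ)
    (hq₀ : ∀ p ∈ Ω, q 0 p = g (p.1 * p.2))
    (hq₁ : ∀ p ∈ Ω, q 1 p = g₁ (p.1 * p.2))
    (hg : g 0 = 0) (hg' : deriv g 0 ≠ 0) :
    ∃ (Ω' : Set (ℂ × ℂ)) (U : Set ℂ)
      (a e₁ e₂ : AnalyticSymbols.FormalSymbol (ℂ × ℂ)) (G : AnalyticSymbols.FormalSymbol ℂ),
      IsOpen Ω' ∧ (0 : ℂ × ℂ) ∈ Ω' ∧ Ω' ⊆ Ω ∧
      IsOpen U ∧ (∀ p ∈ Ω', p.1 * p.2 ∈ U) ∧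
      AnalyticSymbols.IsAnalyticSymbol Ω' a ∧
      AnalyticSymbols.IsAnalyticSymbol U G ∧
      (∀ w ∈ U, G 0 w = g w) ∧
      AnalyticSymbols.IsAnalyticSymbol Ω' e₁ ∧ AnalyticSymbols.IsWeylExp Ω' a e₁ ∧
      AnalyticSymbols.IsAnalyticSymbol Ω' e₂ ∧ AnalyticSymbols.IsWeylExp Ω' (-a) e₂ ∧
      ∀ k : ℕ, ∀ p ∈ Ω',
        AnalyticSymbols.weylMul (AnalyticSymbols.weylMul e₁ q) e₂ k p = G k (p.1 * p.2) := by
  obtain ⟨t₀, Q, ht₀, htΩ, hsym, hQ⟩ := hq.exists_sym hΩ h0 hq₀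
  obtain ⟨s, hs, a, B, hs0, hBd, hB0, hconj⟩ := exists_conjugation Q
    (fun m => (t₀ : ℂ) ^ (2 * m) * taylorCoeff m g) (by
      refine mul_ne_zero (pow_ne_zero _ (Complex.ofReal_ne_zero.2 ht₀.ne')) ?_
      simpa [taylorCoeff] using hg') hQ
  have hs1 : s ≤ 1 := by rwa [Complex.norm_real, Real.norm_of_nonneg hs0.le] at hs
  -- Both dilations, the one placing q in the algebra and the one used for the conjugation, are
  -- undone together.
  set t := s * t₀ with ht
  have ht0 : 0 < t := mul_pos hs0 ht₀
  have htt₀ : t ≤ t₀ := mul_le_of_le_one_left ht₀.le hs1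
  have hqs : ∀ k p, ‖p‖ < t / 4 → q k p = sym t (scaleL s hs Q) k p := fun k p hp =>
    (hsym s hs0 hs1 hs k p (by linarith)).symm
  set r := t / 8 with hr
  have hr0 : 0 < r := by positivity
  have hV : Metric.ball (0 : ℂ × ℂ) r ⊆ Metric.ball 0 (t / 4) :=
    Metric.ball_subset_ball (by linarith)
  have hrn : ‖(r : ℂ)‖ = r := by rw [Complex.norm_real, Real.norm_of_nonneg hr0.le]
  -- Since the conjugated symbol depends only on the product zζ, G(w) is defined as its value at (r,
  -- w/r). This point stays in the domain for |w| < r², which is why U is the disc of radius r².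
  have hw : ∀ w : ℂ, ‖w‖ < r * r → ‖((r : ℂ), w / r)‖ < t / 4 := fun w hw => by
    refine max_lt (by rw [hrn]; linarith) ?_
    rw [norm_div, hrn, div_lt_iff₀ hr0]
    nlinarith
  have hmul : ∀ w : ℂ, (r : ℂ) * (w / r) = w := fun w =>
    mul_div_cancel₀ w (Complex.ofReal_ne_zero.2 hr0.ne')
  have hneg : ∀ k p, ‖p‖ < t / 4 → (-sym t a) k p = sym t (-a) k p := fun k p hp =>
    sym_neg ht0 a k hp
  refine ⟨Metric.ball 0 r, Metric.ball 0 (r * r), sym t a, sym t (NormedSpace.exp a),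
    sym t (NormedSpace.exp (-a)), fun k w => sym t B k (r, w / r), Metric.isOpen_ball,
    Metric.mem_ball_self hr0, (Metric.ball_subset_ball (by linarith)).trans htΩ,
    Metric.isOpen_ball, fun p hp => ?_, isAnalyticSymbol_sym ht0 a hV,
    ⟨fun k => ?_, fun K hK _ => ⟨4 * ‖B‖ + 4 / t ^ 2, by positivity, fun k w hwK => ?_⟩⟩,
    fun w hwU => ?_, isAnalyticSymbol_sym ht0 _ hV, isWeylExp_sym ht0 (fun _ _ _ => rfl) hV,
    isAnalyticSymbol_sym ht0 _ hV, isWeylExp_sym ht0 hneg hV, fun k p hp => ?_⟩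
  · rw [mem_ball_zero_iff] at hp ⊢
    rw [norm_mul]
    exact mul_lt_mul'' ((norm_fst_le p).trans_lt hp) ((norm_snd_le p).trans_lt hp)
      (norm_nonneg _) (norm_nonneg _)
  · exact (differentiableOn_sym ht0 B k).comp
      ((differentiableOn_const _).prodMk (differentiableOn_id.div_const _))
      fun w hwU => mem_ball_zero_iff.2 (hw w (mem_ball_zero_iff.1 hwU))
  · exact norm_sym_le_pow ht0 B k (hw w (mem_ball_zero_iff.1 (hK hwK)))
  · have hw' := hw w (mem_ball_zero_iff.1 hwU)
    -- Conjugation leaves the h^0 coefficient unchanged, so G_0 is read off from q_0.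
    have e : sym t B 0 (r, w / r) = sym t (scaleL s hs Q) 0 (r, w / r) := by
      refine tsum_congr fun i => ?_
      have := hB0 i.1 i.2
      rw [coefL_apply, coefL_apply] at this
      rw [WeylSeries.cf_scale, WeylSeries.cf_scale, this]
    change sym t B 0 (r, w / r) = g w
    rw [e, ← hqs 0 _ hw', hq₀ _ (htΩ (mem_ball_zero_iff.2 (hw'.trans (by linarith)))), hmul]
  · have hp' := mem_ball_zero_iff.1 (hV hp)
    rw [weylMul_eq_sym ht0 (fun k p hp => weylMul_eq_sym ht0 (fun _ _ _ => rfl) hqs k hp)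
      (fun _ _ _ => rfl) k hp', hconj]
    exact sym_eq_of_mul_eq hBd k (hmul _).symm
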